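/- Let $\mathcal K_1,\mathcal K_2$ be complex Hilbert spaces, let $\mathcal H=\mathcal K_1\oplus\mathcal K_2$, and let $P$ be the canonical projection of $\mathcal H$ onto $\mathcal K_1$. Let $A_1$, $A_2$ and $C$ be (possibly unbounded) selfadjoint operators on $\mathcal K_1$, $\mathcal K_2$ and $\mathcal H$ respectively. Suppose that $$D=(A_1\oplus A_2-i)^{-1}-(C-i)^{-1}$$ has rank one, and that $\varphi\in(\ker D)^\perp$ is such that $P\varphi$ is cyclic for $A_1$ and $(1-P)\varphi$ is cyclic for $A_2$. Then $C$ has simple singular spectrum. Here a vector $\varphi$ is cyclic for a selfadjoint operator $A$ if its cyclic subspace, the closed linear span of $\{(A-z)^{-1}\varphi : z\in\mathbb C\setminus\mathbb R\}$, is the whole space. The spectral measure of a vector $\psi$ for $A$ is the finite Borel measure $\mu_\psi$ on $\mathbb R$ with $\langle\psi,(A-z)^{-1}\psi\rangle=\int_{\mathbb R}\frac{d\mu_\psi(x)}{x-z}$ for all $z\in\mathbb C\setminus\mathbb R$. The singular subspace of $A$ is the set of all $\psi$ whose spectral measure $\mu_\psi$ is singular with respect to Lebesgue measure. $A$ has simple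 singular spectrum if its singular subspace is the cyclic subspace of one of its own vectors. -/

import Mathlib

open MeasureTheory

namespace UnboundedOp

variable {H : Type*} [NormedAddCommGroup H] [InnerProductSpace ℂ H]

/-- The orthogonal direct sum `A₁ ⊕ A₂` of two partially defined operators, acting on the Hilbert
space `K₁ ⊕ K₂`: its domain is `dom A₁ ⊕ dom A₂`, and it maps `(x₁, x₂)` to `(A₁ x₁, A₂ x₂)`. -/
def directSum {K₁ K₂ : Type*} [NormedAddCommGroup K₁] [InnerProductSpace ℂ K₁]
    [NormedAddCommGroup K₂] [InnerProductSpace ℂ K₂]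
    (A₁ : K₁ →ₗ.[ℂ] K₁) (A₂ : K₂ →ₗ.[ℂ] K₂) :
    WithLp 2 (K₁ × K₂) →ₗ.[ℂ] WithLp 2 (K₁ × K₂) where
  domain :=
    { carrier := {x | x.fst ∈ A₁.domain ∧ x.snd ∈ A₂.domain}
      add_mem' := fun hx hy => ⟨A₁.domain.add_mem hx.1 hy.1, A₂.domain.add_mem hx.2 hy.2⟩
      zero_mem' := ⟨A₁.domain.zero_mem, A₂.domain.zero_mem⟩
      smul_mem' := fun c _ hx => ⟨A₁.domain.smul_mem c hx.1, A₂.domain.smul_mem c hx.2⟩ }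
  toFun :=
    { toFun := fun x => WithLp.toLp 2 (A₁ ⟨x.1.fst, x.2.1⟩, A₂ ⟨x.1.snd, x.2.2⟩)
      map_add' := fun x y => by
        rw [← WithLp.toLp_add, Prod.mk_add_mk, ← LinearPMap.map_add, ← LinearPMap.map_add]
        rfl
      map_smul' := fun c x => by
        rw [RingHom.id_apply, ← WithLp.toLp_smul, Prod.smul_mk, ← LinearPMap.map_smul,
          ← LinearPMap.map_smul]
        rfl }

/-- `R` is the bounded everywhere defined inverse of `A - z : dom A → H`. -/
def IsResolvent (A : H →ₗ.[ℂ] H) (z : ℂ) (R : H →L[ℂ] H) : Prop :=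
  (∀ y : H, ∃ h : R y ∈ A.domain, A ⟨R y, h⟩ - z • R y = y) ∧
    ∀ x : A.domain, R (A x - z • (x : H)) = x

open Classical in
/-- The resolvent `(A - z)⁻¹`. It is `0` by convention when `A - z` has no bounded everywhere
defined inverse; this does not happen for selfadjoint `A` and non-real `z`, see
`isResolvent_resolvent`. -/
noncomputable def resolvent (A : H →ₗ.[ℂ] H) (z : ℂ) : H →L[ℂ] H :=
  if h : ∃ R, IsResolvent A z R then h.choose else 0

theorem isResolvent_resolvent [CompleteSpace H] {A : H →ₗ.[ℂ] H} (hA : IsSelfAdjoint A) {z : ℂ}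
    (hz : z.im ≠ 0) : IsResolvent A z (resolvent A z) := by
  have hdense := hA.dense_domain
  have hsa : LinearPMap.adjoint A = A := hA
  have hsymm : ∀ x y : A.domain, inner ℂ (A x) (y : H) = inner ℂ (x : H) (A y) := by
    have h := LinearPMap.adjoint_isFormalAdjoint hdense
    rw [hsa] at h
    exact h
  -- the basic estimate, for `z` and its conjugate
  have key : ∀ (w : ℂ) (x : A.domain), |w.im| * ‖(x : H)‖ ≤ ‖A x - w • (x : H)‖ := by
    intro w x
    have h1 : (inner ℂ (x : H) (A x)).im = 0 := by
      rw [← Complex.conj_eq_iff_im, inner_conj_symm]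
      exact hsymm x x
    have h2 : (inner ℂ (x : H) (A x - w • (x : H))).im = - (w.im * ‖(x : H)‖ ^ 2) := by
      rw [inner_sub_right, inner_smul_right, inner_self_eq_norm_sq_to_K, Complex.sub_im, h1]
      simp [← Complex.ofReal_pow]
    have h3 : |w.im| * ‖(x : H)‖ ^ 2 ≤ ‖(x : H)‖ * ‖A x - w • (x : H)‖ := by
      calc |w.im| * ‖(x : H)‖ ^ 2 = |(inner ℂ (x : H) (A x - w • (x : H))).im| := by
            rw [h2, abs_neg, abs_mul, abs_of_nonneg (sq_nonneg ‖(x : H)‖)]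
        _ ≤ ‖inner ℂ (x : H) (A x - w • (x : H))‖ := Complex.abs_im_le_norm _
        _ ≤ _ := norm_inner_le_norm _ _
    rcases (norm_nonneg (x : H)).eq_or_lt with h0 | h0
    · rw [← h0, mul_zero]
      exact norm_nonneg _
    · refine le_of_mul_le_mul_left ?_ h0
      calc ‖(x : H)‖ * (|w.im| * ‖(x : H)‖) = |w.im| * ‖(x : H)‖ ^ 2 := by ring
        _ ≤ _ := h3
  have hz' : 0 < |z.im| := abs_pos.mpr hz
  let T : A.domain →ₗ[ℂ] H := A.toFun - z • A.domain.subtype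
  have hT : ∀ x, T x = A x - z • (x : H) := fun x => rfl
  have hinj : Function.Injective T := by
    rw [← LinearMap.ker_eq_bot, LinearMap.ker_eq_bot']
    intro x hx
    have h := key z x
    rw [← hT, hx, norm_zero] at h
    have : ‖(x : H)‖ = 0 := by
      have := norm_nonneg (x : H)
      nlinarith
    exact Subtype.ext (norm_eq_zero.mp this)
  have hclosed : IsClosed (LinearMap.range T : Set H) := by
    refine isClosed_of_closure_subset fun y hy => ?_
    obtain ⟨u, hu, hlim⟩ := mem_closure_iff_seq_limit.mp hy
    choose x hx using hu
    have hcx : CauchySeq (fun n => (x n : H)) := by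
      have hcu := hlim.cauchySeq
      rw [Metric.cauchySeq_iff] at hcu ⊢
      intro ε hε
      obtain ⟨N, hN⟩ := hcu (|z.im| * ε) (by positivity)
      refine ⟨N, fun m hm n hn => ?_⟩
      have h1 := hN m hm n hn
      have h2 := key z (x m - x n)
      rw [← hT, map_sub, hx, hx, Submodule.coe_sub] at h2
      rw [dist_eq_norm] at h1 ⊢
      exact lt_of_mul_lt_mul_left (h2.trans_lt h1) hz'.le
    obtain ⟨x₀, hx₀⟩ := cauchySeq_tendsto_of_complete hcx
    have hAx : Filter.Tendsto (fun n => A (x n)) Filter.atTop (nhds (y + z • x₀)) := by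
      have : (fun n => A (x n)) = fun n => u n + z • (x n : H) := by
        funext n
        rw [← hx n, hT]
        abel
      rw [this]
      exact hlim.add (hx₀.const_smul z)
    have hmem : (x₀, y + z • x₀) ∈ A.graph :=
      hA.isClosed.mem_of_tendsto (hx₀.prodMk_nhds hAx)
        (Filter.Eventually.of_forall fun n => A.mem_graph (x n))
    obtain ⟨v, hv1, hv2⟩ := (LinearPMap.mem_graph_iff _).mp hmem
    refine ⟨v, ?_⟩
    simp only at hv1 hv2
    rw [hT, hv1, hv2]
    abel
  have horth : (LinearMap.range T)ᗮ = ⊥ := by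
    rw [Submodule.eq_bot_iff]
    intro y hy
    have hy' : ∀ x : A.domain, inner ℂ ((starRingEnd ℂ z) • y) (x : H) = inner ℂ y (A x) := by
      intro x
      have h := (Submodule.mem_orthogonal' _ _).mp hy (T x) ⟨x, rfl⟩
      rw [hT, inner_sub_right, inner_smul_right, sub_eq_zero] at h
      rw [inner_smul_left, h, Complex.conj_conj]
    have hm := LinearPMap.mem_adjoint_domain_of_exists y ⟨_, hy'⟩
    have he := LinearPMap.adjoint_apply_eq hdense ⟨y, hm⟩ hy'
    have hg : (y, (starRingEnd ℂ z) • y) ∈ (LinearPMap.adjoint A).graph :=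
      (LinearPMap.mem_graph_iff _).mpr ⟨⟨y, hm⟩, rfl, he⟩
    rw [hsa] at hg
    obtain ⟨v, hv1, hv2⟩ := (LinearPMap.mem_graph_iff _).mp hg
    simp only at hv1 hv2
    have h := key (starRingEnd ℂ z) v
    rw [hv2, hv1, sub_self, norm_zero, Complex.conj_im, abs_neg] at h
    have : ‖y‖ = 0 := by
      have := norm_nonneg y
      nlinarith
    exact norm_eq_zero.mp this
  have hsurj : Function.Surjective T := by
    have : CompleteSpace (LinearMap.range T) := hclosed.completeSpace_coe
    exact LinearMap.range_eq_top.mp (Submodule.orthogonal_eq_bot_iff.mp horth)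
  let e := LinearEquiv.ofBijective T ⟨hinj, hsurj⟩
  have hR : ∃ R, IsResolvent A z R := by
    refine ⟨(A.domain.subtype ∘ₗ e.symm.toLinearMap).mkContinuous |z.im|⁻¹ fun y => ?_,
      fun y => ⟨(e.symm y).2, ?_⟩, fun x => ?_⟩
    · have h := key z (e.symm y)
      have h' : T (e.symm y) = y := e.apply_symm_apply y
      rw [← hT, h'] at h
      rw [inv_mul_eq_div, le_div_iff₀ hz', mul_comm]
      exact h
    · exact e.apply_symm_apply y
    · exact congrArg Subtype.val (e.symm_apply_apply x)
  rw [resolvent, dif_pos hR]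
  exact hR.choose_spec

/-- The cyclic subspace generated by `φ` and the selfadjoint operator `A`: the closed linear span
of the vectors `(A - z)⁻¹ φ` with `z` non-real. -/
noncomputable def cyclicSubspace (A : H →ₗ.[ℂ] H) (φ : H) : Submodule ℂ H :=
  (Submodule.span ℂ {x | ∃ z : ℂ, z.im ≠ 0 ∧ x = resolvent A z φ}).topologicalClosure

/-- `φ` is a cyclic vector for the selfadjoint operator `A`. -/
def IsCyclic (A : H →ₗ.[ℂ] H) (φ : H) : Prop :=
  cyclicSubspace A φ = ⊤

/-- `μ` is the spectral measure of the vector `ψ` for the selfadjoint operator `A`, that is,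
the (unique) finite Borel measure on `ℝ` with `⟨ψ, f(A) ψ⟩ = ∫ f dμ`; it is pinned down by the
resolvent functions `f(x) = (x - z)⁻¹` with `z` non-real. -/
def IsSpectralMeasure (A : H →ₗ.[ℂ] H) (ψ : H) (μ : Measure ℝ) : Prop :=
  IsFiniteMeasure μ ∧
    ∀ z : ℂ, z.im ≠ 0 → inner ℂ ψ (resolvent A z ψ) = ∫ x : ℝ, ((x : ℂ) - z)⁻¹ ∂μ

/-- The singular subspace of the selfadjoint operator `A`: the vectors whose spectral measure is
singular with respect to Lebesgue measure (the pure point and the singular continuous part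
together). -/
def singularSubspace (A : H →ₗ.[ℂ] H) : Set H :=
  {ψ | ∃ μ : Measure ℝ, IsSpectralMeasure A ψ μ ∧ μ ⟂ₘ volume}

/-- The selfadjoint operator `A` has simple singular spectrum: its restriction to the singular
subspace has a cyclic vector. -/
def HasSimpleSingularSpectrum (A : H →ₗ.[ℂ] H) : Prop :=
  ∃ ψ ∈ singularSubspace A, (cyclicSubspace A ψ : Set H) = singularSubspace A

end UnboundedOp

namespace UnboundedOp

open Filter Topology Complex
open scoped BoundedContinuousFunction ComplexConjugate CompactlySupported

/-! ### Kernels of the Stieltjes transform -/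

/-! Let R and R' be the resolvents of A₁ ⊕ A₂ and of C, and write D = ⟨φ, ·⟩η. The cyclic subspace
of φ is the same for R and R', and on its orthogonal complement R and R' agree. Let χ be the
component of ξ = (Pφ, 0) in that complement. Since φ and ξ generate everything under R, the space is
the orthogonal sum of the R'-cyclic subspaces of φ and χ. So C has multiplicity at most two, and it
remains to see that the singular parts of the spectral measures μ of φ and ν of χ for C have
disjoint carriers.

The imaginary part of a Stieltjes transform tends to infinity almost everywhere for the singular
part of its measure (`ae_singularPart_tendsto_im_stieltjes`). For μ this is blow-up of G = ⟨φ, R'φ⟩.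
For ν, the bound ‖R'χ‖ ≤ ‖Rξ‖ ≤ ‖Rφ‖ transfers the blow-up to F = ⟨φ, Rφ⟩. The Aronszajn–Krein
relation (`exists_aronszajn_krein`), divided by FG, reads 1/G - 1/F = κ(‖φ‖²/G + z - i)(‖φ‖²/F + z +
i). If F and G both blew up at a real x, the limit would be 0 = κ(x² + 1) with κ ≠ 0
(`not_tendsto_both`).

With disjoint null carriers S and T, the vector that is 1_S in L²(μ) and 1_T in L²(ν) generates the
singular subspace (`IsResolventFamily.exists_cyclicSpan_eq_singularVectors`). -/

theorem ofReal_sub_ne_zero {z : ℂ} (hz : z.im ≠ 0) (x : ℝ) : (x : ℂ) - z ≠ 0 := by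
  intro h
  apply hz
  have := congrArg Complex.im h
  simpa using this

theorem norm_inv_ofReal_sub_le {z : ℂ} (hz : z.im ≠ 0) (x : ℝ) :
    ‖((x : ℂ) - z)⁻¹‖ ≤ |z.im|⁻¹ := by
  rw [norm_inv]
  refine inv_anti₀ (abs_pos.mpr hz) ?_
  have := Complex.abs_im_le_norm ((x : ℂ) - z)
  simpa using this

theorem continuous_inv_ofReal_sub {z : ℂ} (hz : z.im ≠ 0) :
    Continuous fun x : ℝ => ((x : ℂ) - z)⁻¹ :=
  (Complex.continuous_ofReal.sub continuous_const).inv₀ (ofReal_sub_ne_zero hz)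

open Classical in
/-- The function `x ↦ (x - z)⁻¹` on the real line, as a bounded continuous function (`0` for
real `z`). -/
noncomputable def kernelBCF (z : ℂ) : ℝ →ᵇ ℂ :=
  if hz : z.im ≠ 0 then
    BoundedContinuousFunction.ofNormedAddCommGroup (fun x : ℝ => ((x : ℂ) - z)⁻¹)
      (continuous_inv_ofReal_sub hz) |z.im|⁻¹ (norm_inv_ofReal_sub_le hz)
  else 0

theorem kernelBCF_apply {z : ℂ} (hz : z.im ≠ 0) (x : ℝ) :
    kernelBCF z x = ((x : ℂ) - z)⁻¹ := by
  rw [kernelBCF, dif_pos hz]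
  rfl

theorem norm_kernelBCF_le {z : ℂ} (hz : z.im ≠ 0) : ‖kernelBCF z‖ ≤ |z.im|⁻¹ := by
  refine (BoundedContinuousFunction.norm_le (by positivity)).mpr fun x => ?_
  rw [kernelBCF_apply hz]
  exact norm_inv_ofReal_sub_le hz x

theorem kernelBCF_sub {z w : ℂ} (hz : z.im ≠ 0) (hw : w.im ≠ 0) :
    kernelBCF z - kernelBCF w = (z - w) • (kernelBCF z * kernelBCF w) := by
  ext x
  have h1 := ofReal_sub_ne_zero hz x
  have h2 := ofReal_sub_ne_zero hw x
  simp only [BoundedContinuousFunction.coe_sub, Pi.sub_apply, BoundedContinuousFunction.coe_smul,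
    BoundedContinuousFunction.coe_mul, Pi.mul_apply, kernelBCF_apply hz, kernelBCF_apply hw,
    smul_eq_mul]
  field_simp
  ring

theorem star_kernelBCF (z : ℂ) : star (kernelBCF z) = kernelBCF (conj z) := by
  by_cases hz : z.im ≠ 0
  · ext x
    have hz' : (conj z).im ≠ 0 := by simpa using hz
    rw [BoundedContinuousFunction.star_apply, kernelBCF_apply hz, kernelBCF_apply hz']
    simp
  · have hz' : ¬ (conj z).im ≠ 0 := by simpa using hz
    rw [kernelBCF, kernelBCF, dif_neg hz, dif_neg hz', star_zero]

/-- A family satisfying the resolvent identity is continuous along horizontal shifts. -/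
theorem tendsto_of_resolvent_identity {𝔸 : Type*} [NormedRing 𝔸] [NormedAlgebra ℂ 𝔸] {R : ℂ → 𝔸}
    (hres : ∀ z w : ℂ, z.im ≠ 0 → w.im ≠ 0 → R z - R w = (z - w) • (R z * R w))
    (hb : ∀ z : ℂ, z.im ≠ 0 → ‖R z‖ ≤ |z.im|⁻¹) {w : ℂ} (hw : w.im ≠ 0) :
    Tendsto (fun n : ℕ => R (w + (1 / ((n : ℝ) + 1) : ℝ))) atTop (𝓝 (R w)) := by
  rw [tendsto_iff_norm_sub_tendsto_zero]
  have h0 : Tendsto (fun n : ℕ => (1 / ((n : ℝ) + 1)) * (|w.im|⁻¹ * |w.im|⁻¹)) atTop (𝓝 0) := by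
    simpa using tendsto_one_div_add_atTop_nhds_zero_nat.mul_const (|w.im|⁻¹ * |w.im|⁻¹)
  refine squeeze_zero (fun n => norm_nonneg _) (fun n => ?_) h0
  have hn : (w + (1 / ((n : ℝ) + 1) : ℝ) : ℂ).im = w.im := by simp
  have hn' : (w + (1 / ((n : ℝ) + 1) : ℝ) : ℂ).im ≠ 0 := by rwa [hn]
  rw [hres _ _ hn' hw, norm_smul, add_sub_cancel_left, Complex.norm_real,
    Real.norm_of_nonneg (by positivity)]
  refine mul_le_mul_of_nonneg_left ((norm_mul_le _ _).trans ?_) (by positivity)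
  have := hb _ hn'
  rw [hn] at this
  exact mul_le_mul this (hb _ hw) (norm_nonneg _) (by positivity)

theorem add_shift_ne (w : ℂ) (n : ℕ) : w + (1 / ((n : ℝ) + 1) : ℝ) ≠ w := by
  intro h
  have h1 : ((1 / ((n : ℝ) + 1) : ℝ) : ℂ) = 0 := by simpa using h
  have h2 : (1 / ((n : ℝ) + 1) : ℝ) ≠ 0 := by positivity
  exact h2 (by exact_mod_cast h1)

theorem add_shift_im (w : ℂ) (n : ℕ) : (w + (1 / ((n : ℝ) + 1) : ℝ)).im = w.im := by simp

theorem tendsto_kernelBCF {w : ℂ} (hw : w.im ≠ 0) :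
    Tendsto (fun n : ℕ => kernelBCF (w + (1 / ((n : ℝ) + 1) : ℝ))) atTop (𝓝 (kernelBCF w)) :=
  tendsto_of_resolvent_identity (fun _ _ hz hw => kernelBCF_sub hz hw)
    (fun _ hz => norm_kernelBCF_le hz) hw

/-- The closed linear span of `1` and the kernels `(x - z)⁻¹`. -/
noncomputable def kernelSpan : Submodule ℂ (ℝ →ᵇ ℂ) :=
  (Submodule.span ℂ ({1} ∪ {g | ∃ z : ℂ, z.im ≠ 0 ∧ g = kernelBCF z})).topologicalClosure

theorem kernelSpan_induction {p : (ℝ →ᵇ ℂ) → Prop} (one : p 1)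
    (kernel : ∀ z : ℂ, z.im ≠ 0 → p (kernelBCF z)) (add : ∀ f g, p f → p g → p (f + g))
    (smul : ∀ (c : ℂ) f, p f → p (c • f)) (closed : IsClosed {f | p f}) {f : ℝ →ᵇ ℂ}
    (hf : f ∈ kernelSpan) : p f := by
  have h : ∀ g ∈ Submodule.span ℂ ({1} ∪ {g | ∃ z : ℂ, z.im ≠ 0 ∧ g = kernelBCF z}), p g := by
    intro g hg
    induction hg using Submodule.span_induction with
    | mem x hx =>
      rcases hx with hx | ⟨z, hz, rfl⟩
      · rw [Set.mem_singleton_iff.mp hx]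
        exact one
      · exact kernel z hz
    | zero => simpa using smul 0 1 one
    | add x y _ _ hx hy => exact add x y hx hy
    | smul a x _ hx => exact smul a x hx
  exact closure_minimal h closed hf

theorem one_mem_kernelSpan : (1 : ℝ →ᵇ ℂ) ∈ kernelSpan :=
  Submodule.le_topologicalClosure _ (Submodule.subset_span (Or.inl rfl))

theorem kernelBCF_mem_kernelSpan {z : ℂ} (hz : z.im ≠ 0) : kernelBCF z ∈ kernelSpan :=
  Submodule.le_topologicalClosure _ (Submodule.subset_span (Or.inr ⟨z, hz, rfl⟩))

theorem isClosed_kernelSpan : IsClosed (kernelSpan : Set (ℝ →ᵇ ℂ)) :=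
  Submodule.isClosed_topologicalClosure _

/-- Off the diagonal the product is a difference quotient of kernels; the square is a norm limit of
such products, obtained by shifting one of the two points. -/
theorem kernelBCF_mul_mem {z w : ℂ} (hz : z.im ≠ 0) (hw : w.im ≠ 0) :
    kernelBCF z * kernelBCF w ∈ kernelSpan := by
  have key : ∀ u : ℂ, u.im ≠ 0 → u ≠ w → kernelBCF u * kernelBCF w ∈ kernelSpan := by
    intro u hu huw
    have h : kernelBCF u * kernelBCF w = (u - w)⁻¹ • (kernelBCF u - kernelBCF w) := by
      rw [kernelBCF_sub hu hw, smul_smul, inv_mul_cancel₀ (sub_ne_zero.mpr huw), one_smul]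
    rw [h]
    exact kernelSpan.smul_mem _
      (kernelSpan.sub_mem (kernelBCF_mem_kernelSpan hu) (kernelBCF_mem_kernelSpan hw))
  by_cases hzw : z = w
  · subst hzw
    refine isClosed_kernelSpan.mem_of_tendsto ((tendsto_kernelBCF hz).mul_const (kernelBCF z))
      (Eventually.of_forall fun n => key _ ?_ (add_shift_ne z n))
    rwa [add_shift_im]
  · exact key z hz hzw

theorem mul_mem_kernelSpan {f g : ℝ →ᵇ ℂ} (hf : f ∈ kernelSpan) (hg : g ∈ kernelSpan) :
    f * g ∈ kernelSpan := by
  have hk : ∀ w : ℂ, w.im ≠ 0 → ∀ f ∈ kernelSpan, f * kernelBCF w ∈ kernelSpan := by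
    intro w hw f hf
    refine kernelSpan_induction (p := fun f => f * kernelBCF w ∈ kernelSpan) ?_ ?_ ?_ ?_ ?_ hf
    · rw [one_mul]
      exact kernelBCF_mem_kernelSpan hw
    · intro z hz
      exact kernelBCF_mul_mem hz hw
    · intro a b ha hb
      rw [add_mul]
      exact kernelSpan.add_mem ha hb
    · intro c a ha
      rw [smul_mul_assoc]
      exact kernelSpan.smul_mem c ha
    · exact isClosed_kernelSpan.preimage (continuous_mul_const _)
  refine kernelSpan_induction (p := fun g => f * g ∈ kernelSpan) ?_ ?_ ?_ ?_ ?_ hg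
  · rwa [mul_one]
  · intro z hz
    exact hk z hz f hf
  · intro a b ha hb
    rw [mul_add]
    exact kernelSpan.add_mem ha hb
  · intro c a ha
    rw [mul_smul_comm]
    exact kernelSpan.smul_mem c ha
  · exact isClosed_kernelSpan.preimage (continuous_const_mul _)

theorem star_mem_kernelSpan {f : ℝ →ᵇ ℂ} (hf : f ∈ kernelSpan) : star f ∈ kernelSpan := by
  refine kernelSpan_induction (p := fun f => star f ∈ kernelSpan) ?_ ?_ ?_ ?_ ?_ hf
  · rw [star_one]
    exact one_mem_kernelSpan
  · intro z hz
    rw [star_kernelBCF]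
    exact kernelBCF_mem_kernelSpan (by simpa using hz)
  · intro a b ha hb
    rw [star_add]
    exact kernelSpan.add_mem ha hb
  · intro c a ha
    rw [star_smul]
    exact kernelSpan.smul_mem _ ha
  · exact isClosed_kernelSpan.preimage continuous_star

/-- The closed span of `1` and the kernels, as a star subalgebra. -/
noncomputable def kernelAlgebra : StarSubalgebra ℂ (ℝ →ᵇ ℂ) where
  carrier := kernelSpan
  mul_mem' := mul_mem_kernelSpan
  one_mem' := one_mem_kernelSpan
  add_mem' := kernelSpan.add_mem
  zero_mem' := kernelSpan.zero_mem
  algebraMap_mem' c := by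
    rw [Algebra.algebraMap_eq_smul_one]
    exact kernelSpan.smul_mem c one_mem_kernelSpan
  star_mem' := star_mem_kernelSpan

/-! ### Uniqueness for the Stieltjes transform -/

theorem integral_kernelBCF {z : ℂ} (hz : z.im ≠ 0) (μ : Measure ℝ) :
    ∫ x, kernelBCF z x ∂μ = ∫ x : ℝ, ((x : ℂ) - z)⁻¹ ∂μ :=
  integral_congr_ae (Eventually.of_forall fun x => kernelBCF_apply hz x)

/-- The factor -iy/(x - iy) has modulus at most 1 and tends to 1 as y → ∞. Hence the total integral
can be read off from the transform; y = n + 1 stays away from 0. -/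
theorem tendsto_nat_mul_I_kernel (f : ℝ → ℂ) (μ : Measure ℝ) (hf : Integrable f μ) :
    Tendsto (fun n : ℕ => -(((n : ℂ) + 1) * I) * ∫ x : ℝ, f x * ((x : ℂ) - ((n : ℂ) + 1) * I)⁻¹ ∂μ)
      atTop (𝓝 (∫ x, f x ∂μ)) := by
  have him : ∀ n : ℕ, (((n : ℂ) + 1) * I).im ≠ 0 := by
    intro n
    have : (((n : ℂ) + 1) * I).im = (n : ℝ) + 1 := by simp
    rw [this]
    positivity
  simp_rw [← integral_const_mul]
  refine tendsto_integral_of_dominated_convergence (fun x => ‖f x‖) ?_ hf.norm ?_ ?_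
  · intro n
    exact (hf.aestronglyMeasurable.mul
      (continuous_inv_ofReal_sub (him n)).aestronglyMeasurable).const_mul _
  · intro n
    refine Eventually.of_forall fun x => ?_
    have h1 := norm_inv_ofReal_sub_le (him n) x
    have h2 : ‖-(((n : ℂ) + 1) * I)‖ = (n : ℝ) + 1 := by
      rw [norm_neg, norm_mul, Complex.norm_I, mul_one]
      exact_mod_cast Complex.norm_natCast (n + 1)
    have h3 : |(((n : ℂ) + 1) * I).im| = (n : ℝ) + 1 := by
      have : (((n : ℂ) + 1) * I).im = (n : ℝ) + 1 := by simp
      rw [this, abs_of_nonneg (by positivity)]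
    rw [h3] at h1
    rw [norm_mul, norm_mul, h2]
    calc ((n : ℝ) + 1) * (‖f x‖ * ‖((x : ℂ) - ((n : ℂ) + 1) * I)⁻¹‖)
        ≤ ((n : ℝ) + 1) * (‖f x‖ * ((n : ℝ) + 1)⁻¹) := by gcongr
      _ = ‖f x‖ := by field_simp
  · refine Eventually.of_forall fun x => ?_
    have h1 : ∀ n : ℕ, -(((n : ℂ) + 1) * I) * (f x * ((x : ℂ) - ((n : ℂ) + 1) * I)⁻¹)
        = f x * (1 - (x / ((n : ℂ) + 1)) * (-I))⁻¹ := by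
      intro n
      have h0 : ((n : ℂ) + 1) ≠ 0 := by exact_mod_cast Nat.succ_ne_zero n
      have h2 := ofReal_sub_ne_zero (him n) x
      have h3 : (1 - (x / ((n : ℂ) + 1)) * (-I)) = ((x : ℂ) - ((n : ℂ) + 1) * I) *
          (-(((n : ℂ) + 1) * I))⁻¹ := by
        have hI := Complex.I_sq
        field_simp
        linear_combination (x : ℂ) * hI
      rw [h3, mul_inv, inv_inv]
      ring
    simp_rw [h1]
    have h4 : Tendsto (fun n : ℕ => (x : ℂ) / ((n : ℂ) + 1)) atTop (𝓝 0) := by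
      have := (tendsto_one_div_add_atTop_nhds_zero_nat (𝕜 := ℂ)).const_mul (x : ℂ)
      simpa [mul_one_div, div_eq_mul_inv] using this
    have h5 : Tendsto (fun n : ℕ => (1 - ((x : ℂ) / ((n : ℂ) + 1)) * (-I))⁻¹) atTop (𝓝 1) := by
      have := (tendsto_const_nhds (x := (1 : ℂ))).sub (h4.mul_const (-I))
      simpa using this.inv₀ (by simp)
    simpa using h5.const_mul (f x)

theorem continuous_integral_boundedContinuousFunction (μ : Measure ℝ) [IsFiniteMeasure μ] :
    Continuous fun f : ℝ →ᵇ ℂ => ∫ x, f x ∂μ := by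
  have := (continuous_integral (G := ℂ) (μ := μ)).comp
    (BoundedContinuousFunction.toLp 1 μ ℂ (E := ℂ)).continuous
  exact this.congr fun f => integral_congr_ae (BoundedContinuousFunction.coeFn_toLp 1 μ ℂ f)

/-- A finite measure is determined by its Stieltjes transform. -/
theorem measure_ext_of_stieltjes {μ ν : Measure ℝ} [IsFiniteMeasure μ] [IsFiniteMeasure ν]
    (h : ∀ z : ℂ, z.im ≠ 0 → ∫ x : ℝ, ((x : ℂ) - z)⁻¹ ∂μ = ∫ x : ℝ, ((x : ℂ) - z)⁻¹ ∂ν) :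
    μ = ν := by
  -- A star subalgebra of bounded continuous functions that separates points determines a finite
  -- measure on the line.
  refine ext_of_forall_mem_subalgebra_integral_eq_of_pseudoEMetric_complete_countable
    (𝕜 := ℂ) (A := kernelAlgebra) ?_ ?_
  · intro x y hxy
    have hI : (I : ℂ).im ≠ 0 := by simp
    refine ⟨_, ⟨BoundedContinuousFunction.toContinuousMapStarₐ ℂ (kernelBCF I),
      ⟨kernelBCF I, kernelBCF_mem_kernelSpan hI, rfl⟩, rfl⟩, ?_⟩
    change kernelBCF I x ≠ kernelBCF I y
    rw [kernelBCF_apply hI, kernelBCF_apply hI]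
    intro he
    apply hxy
    have := inv_injective he
    exact_mod_cast sub_left_injective this
  · intro g hg
    have hint : ∀ (m : Measure ℝ) [IsFiniteMeasure m] (f : ℝ →ᵇ ℂ), Integrable f m :=
      fun m _ f => f.integrable m
    refine kernelSpan_induction (p := fun g : ℝ →ᵇ ℂ => ∫ x, g x ∂μ = ∫ x, g x ∂ν)
      ?_ ?_ ?_ ?_ ?_ hg
    -- The constant 1 is not a kernel; its integral comes from the transform far up the imaginary
    -- axis.
    · have h1 := tendsto_nat_mul_I_kernel (fun _ => 1) μ (integrable_const _)
      have h2 := tendsto_nat_mul_I_kernel (fun _ => 1) ν (integrable_const _)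
      refine tendsto_nhds_unique (h1.congr fun n => ?_) h2
      simp only [one_mul]
      rw [h]
      have : (((n : ℂ) + 1) * I).im = (n : ℝ) + 1 := by simp
      rw [this]
      positivity
    · intro z hz
      rw [integral_kernelBCF hz, integral_kernelBCF hz, h z hz]
    · intro a b ha hb
      simp only [BoundedContinuousFunction.coe_add, Pi.add_apply]
      rw [integral_add (hint _ a) (hint _ b), integral_add (hint _ a) (hint _ b), ha, hb]
    · intro c a ha
      simp only [BoundedContinuousFunction.coe_smul]
      rw [integral_smul, integral_smul, ha]
    · exact isClosed_eq (continuous_integral_boundedContinuousFunction μ)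
        (continuous_integral_boundedContinuousFunction ν)

theorem integrable_mul_kernel {μ : Measure ℝ} {f : ℝ → ℂ} (hf : Integrable f μ) {z : ℂ}
    (hz : z.im ≠ 0) : Integrable (fun x : ℝ => f x * ((x : ℂ) - z)⁻¹) μ :=
  hf.mul_bdd (c := |z.im|⁻¹) (continuous_inv_ofReal_sub hz).aestronglyMeasurable
    (Eventually.of_forall (norm_inv_ofReal_sub_le hz))

/-- The measures f⁺μ and f⁻μ are finite with equal transforms, hence equal. So f⁺ = f⁻ almost
everywhere, and one of the two is always 0. -/
theorem ae_eq_zero_of_stieltjes_real {μ : Measure ℝ} {f : ℝ → ℝ} (hf : Integrable f μ)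
    (h : ∀ z : ℂ, z.im ≠ 0 → ∫ x : ℝ, (f x : ℂ) * ((x : ℂ) - z)⁻¹ ∂μ = 0) : f =ᵐ[μ] 0 := by
  have hp : AEMeasurable (fun x => ENNReal.ofReal (f x)) μ := hf.aemeasurable.ennreal_ofReal
  have hm : AEMeasurable (fun x => ENNReal.ofReal (-f x)) μ := hf.aemeasurable.neg.ennreal_ofReal
  have : IsFiniteMeasure (μ.withDensity fun x => ENNReal.ofReal (f x)) :=
    isFiniteMeasure_withDensity_ofReal hf.2
  have : IsFiniteMeasure (μ.withDensity fun x => ENNReal.ofReal (-f x)) :=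
    isFiniteMeasure_withDensity_ofReal hf.neg.2
  have key : (μ.withDensity fun x => ENNReal.ofReal (f x)) =
      μ.withDensity fun x => ENNReal.ofReal (-f x) := by
    refine measure_ext_of_stieltjes fun z hz => ?_
    rw [integral_withDensity_eq_integral_toReal_smul₀ hp (by simp),
      integral_withDensity_eq_integral_toReal_smul₀ hm (by simp), ← sub_eq_zero, ← integral_sub]
    · rw [← h z hz]
      refine integral_congr_ae (Eventually.of_forall fun x => ?_)
      simp only [ENNReal.toReal_ofReal', Complex.real_smul]
      rcases le_total 0 (f x) with hx | hx
      · rw [max_eq_left hx, max_eq_right (by linarith)]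
        simp
      · rw [max_eq_right hx, max_eq_left (by linarith)]
        simp
    · have := integrable_mul_kernel (hf.pos_part.ofReal (𝕜 := ℂ)) hz
      simpa [ENNReal.toReal_ofReal'] using this
    · have := integrable_mul_kernel (hf.neg_part.ofReal (𝕜 := ℂ)) hz
      simpa [ENNReal.toReal_ofReal'] using this
  have hne : ∫⁻ x, ENNReal.ofReal (f x) ∂μ ≠ ⊤ := by
    have := measure_ne_top (μ.withDensity fun x => ENNReal.ofReal (f x)) Set.univ
    rwa [withDensity_apply _ MeasurableSet.univ, Measure.restrict_univ] at this
  filter_upwards [(withDensity_eq_iff hp hm hne).mp key] with x hx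
  rcases le_total 0 (f x) with h0 | h0
  · rw [ENNReal.ofReal_of_nonpos (neg_nonpos.mpr h0), ENNReal.ofReal_eq_zero] at hx
    exact le_antisymm hx h0
  · rw [ENNReal.ofReal_of_nonpos h0, eq_comm, ENNReal.ofReal_eq_zero] at hx
    exact le_antisymm h0 (by simpa using hx)

/-- An integrable density with vanishing Stieltjes transform vanishes almost everywhere. -/
theorem ae_eq_zero_of_stieltjes {μ : Measure ℝ} {f : ℝ → ℂ} (hf : Integrable f μ)
    (h : ∀ z : ℂ, z.im ≠ 0 → ∫ x : ℝ, f x * ((x : ℂ) - z)⁻¹ ∂μ = 0) : f =ᵐ[μ] 0 := by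
  have key : ∀ g : ℝ → ℂ, Integrable g μ →
      (∀ z : ℂ, z.im ≠ 0 → ∫ x : ℝ, g x * ((x : ℂ) - z)⁻¹ ∂μ = 0) →
      (fun x => (g x).re) =ᵐ[μ] 0 := by
    intro g hg hgz
    refine ae_eq_zero_of_stieltjes_real hg.re fun z hz => ?_
    have hz' : (conj z).im ≠ 0 := by simpa using hz
    have h1 := hgz z hz
    -- Conjugating the hypothesis at the conjugate point shows that the conjugate density also has
    -- vanishing transform, hence so does the real part.
    have h2 : ∫ x : ℝ, conj (g x) * ((x : ℂ) - z)⁻¹ ∂μ = 0 := by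
      have h3 := congrArg conj (hgz (conj z) hz')
      rw [← integral_conj, map_zero] at h3
      rw [← h3]
      refine integral_congr_ae (Eventually.of_forall fun x => ?_)
      simp
    have hgc : Integrable (fun x => conj (g x)) μ :=
      (RCLike.conjCLE (K := ℂ)).toContinuousLinearMap.integrable_comp hg
    have h4 := integral_add (integrable_mul_kernel hg hz) (integrable_mul_kernel hgc hz)
    rw [h1, h2, add_zero] at h4
    have h5 : ∀ x : ℝ, ((g x).re : ℂ) * ((x : ℂ) - z)⁻¹ =
        2⁻¹ * (g x * ((x : ℂ) - z)⁻¹ + conj (g x) * ((x : ℂ) - z)⁻¹) := by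
      intro x
      rw [← add_mul, Complex.add_conj]
      push_cast
      ring
    refine (integral_congr_ae (Eventually.of_forall h5)).trans ?_
    rw [integral_const_mul, h4, mul_zero]
  have h1 := key f hf h
  have h2 := key (fun x => -I * f x) (hf.const_mul _) fun z hz => by
    simp_rw [mul_assoc]
    rw [integral_const_mul, h z hz, mul_zero]
  filter_upwards [h1, h2] with x hx1 hx2
  refine Complex.ext hx1 ?_
  simpa using hx2

/-- The kernel `x ↦ (x - z)⁻¹` as an element of `L²(μ)`. -/
noncomputable def kernelLp (μ : Measure ℝ) [IsFiniteMeasure μ] (z : ℂ) : Lp ℂ 2 μ :=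
  BoundedContinuousFunction.toLp 2 μ ℂ (kernelBCF z)

theorem coeFn_kernelLp (μ : Measure ℝ) [IsFiniteMeasure μ] {z : ℂ} (hz : z.im ≠ 0) :
    kernelLp μ z =ᵐ[μ] fun x : ℝ => ((x : ℂ) - z)⁻¹ := by
  filter_upwards [BoundedContinuousFunction.coeFn_toLp 2 μ ℂ (kernelBCF z)] with x hx
  rw [kernelLp, hx, kernelBCF_apply hz]

theorem integrable_of_Lp_two {μ : Measure ℝ} [IsFiniteMeasure μ] (f : Lp ℂ 2 μ) :
    Integrable f μ :=
  (Lp.memLp f).integrable (by norm_num)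

theorem inner_kernelLp (μ : Measure ℝ) [IsFiniteMeasure μ] {z : ℂ} (hz : z.im ≠ 0)
    (f : Lp ℂ 2 μ) :
    inner ℂ (kernelLp μ z) f = ∫ x : ℝ, f x * ((x : ℂ) - conj z)⁻¹ ∂μ := by
  rw [L2.inner_def]
  refine integral_congr_ae ?_
  filter_upwards [coeFn_kernelLp μ hz] with x hx
  rw [hx]
  simp

/-- The kernels `(x - z)⁻¹` span a dense subspace of `L²(μ)`. -/
theorem span_kernelLp_dense (μ : Measure ℝ) [IsFiniteMeasure μ] :
    (Submodule.span ℂ {f | ∃ z : ℂ, z.im ≠ 0 ∧ f = kernelLp μ z}).topologicalClosure = ⊤ := by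
  rw [Submodule.topologicalClosure_eq_top_iff, Submodule.eq_bot_iff]
  intro f hf
  have h : f =ᵐ[μ] 0 := by
    refine ae_eq_zero_of_stieltjes (integrable_of_Lp_two f) fun z hz => ?_
    have hz' : (conj z).im ≠ 0 := by simpa using hz
    have := (Submodule.mem_orthogonal _ _).mp hf _ (Submodule.subset_span ⟨conj z, hz', rfl⟩)
    rw [inner_kernelLp μ hz'] at this
    simpa using this
  exact (Lp.eq_zero_iff_ae_eq_zero).mpr h

/-- At almost every point of the singular part of a finite measure, the imaginary part of the
Stieltjes transform tends to infinity along the vertical line. -/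
theorem ae_singularPart_tendsto_im_stieltjes (μ : Measure ℝ) [IsFiniteMeasure μ] :
    ∀ᵐ x : ℝ ∂(μ.singularPart volume),
      Tendsto (fun ε : ℝ => (∫ t : ℝ, ((t : ℂ) - (x + ε * I))⁻¹ ∂μ).im) (𝓝[>] 0) atTop := by
  set σ := μ.singularPart volume with hσ
  have hle : σ ≤ μ := Measure.singularPart_le μ volume
  -- Lebesgue measure is differentiated with respect to σ: by mutual singularity the ratio of ball
  -- measures vol/σ tends to 0 at σ-almost every point.
  filter_upwards [Besicovitch.ae_tendsto_rnDeriv volume σ,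
    (Measure.mutuallySingular_singularPart μ volume).symm.rnDeriv_ae_eq_zero] with x hx1 hx2
  rw [hx2, Pi.zero_apply] at hx1
  rw [tendsto_atTop]
  intro M
  set M' := max M 1 with hM'
  have hMpos : 0 < M' := lt_of_lt_of_le one_pos (le_max_right _ _)
  have hev := hx1.eventually (gt_mem_nhds (ENNReal.ofReal_pos.mpr (inv_pos.mpr hMpos)))
  filter_upwards [hev, self_mem_nhdsWithin] with ε hε hε0
  have hε0 : 0 < ε := hε0
  set B := Metric.closedBall x ε with hB
  have him : ((x : ℂ) + ε * I).im ≠ 0 := by simpa using hε0.ne'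
  have h1 : 2 * ε ≤ M'⁻¹ * μ.real B := by
    have h2 : volume B ≤ ENNReal.ofReal M'⁻¹ * σ B :=
      (ENNReal.div_le_iff_le_mul (Or.inr ENNReal.ofReal_ne_top)
        (Or.inl (measure_ne_top σ B))).mp hε.le
    rw [hB, Real.volume_closedBall, ← hB] at h2
    have h3 : ENNReal.ofReal (2 * ε) ≤ ENNReal.ofReal M'⁻¹ * μ B :=
      h2.trans (mul_le_mul_right (hle B) _)
    have h4 := ENNReal.toReal_mono (ENNReal.mul_ne_top ENNReal.ofReal_ne_top
      (measure_ne_top μ B)) h3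
    rw [ENNReal.toReal_mul, ENNReal.toReal_ofReal (by positivity),
      ENNReal.toReal_ofReal (by positivity)] at h4
    exact h4
  have hint : Integrable (fun t : ℝ => ((t : ℂ) - (x + ε * I))⁻¹) μ := by
    simpa using integrable_mul_kernel (integrable_const (μ := μ) (1 : ℂ)) him
  have hval : ∀ t : ℝ, (((t : ℂ) - (x + ε * I))⁻¹).im = ε / ((t - x) ^ 2 + ε ^ 2) := by
    intro t
    rw [Complex.inv_im]
    simp [Complex.normSq_apply]
    ring
  have h5 : (∫ t : ℝ, ((t : ℂ) - (x + ε * I))⁻¹ ∂μ).im =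
      ∫ t : ℝ, ε / ((t - x) ^ 2 + ε ^ 2) ∂μ := by
    have := Complex.imCLM.integral_comp_comm hint
    simp only [Complex.imCLM_apply] at this
    rw [← this]
    exact integral_congr_ae (Eventually.of_forall hval)
  have hint' : Integrable (fun t : ℝ => ε / ((t - x) ^ 2 + ε ^ 2)) μ := by
    have := Complex.imCLM.integrable_comp hint
    exact this.congr (Eventually.of_forall hval)
  -- On the ball |t - x| ≤ ε the Poisson kernel is at least 1/(2ε), so the transform dominates the
  -- density of μ at scale ε.
  have h6 : (2 * ε)⁻¹ * μ.real B ≤ ∫ t : ℝ, ε / ((t - x) ^ 2 + ε ^ 2) ∂μ := by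
    have hBm : MeasurableSet B := Metric.isClosed_closedBall.measurableSet
    calc (2 * ε)⁻¹ * μ.real B = ∫ t in B, (2 * ε)⁻¹ ∂μ := by
          rw [setIntegral_const, smul_eq_mul, mul_comm]
      _ ≤ ∫ t in B, ε / ((t - x) ^ 2 + ε ^ 2) ∂μ := by
          refine setIntegral_mono_on (integrable_const _) hint'.integrableOn hBm fun t ht => ?_
          have ht' : |t - x| ≤ ε := by simpa [hB, Real.dist_eq] using ht
          have h7 : (t - x) ^ 2 ≤ ε ^ 2 := by
            rw [← sq_abs]
            gcongr
          rw [inv_eq_one_div, div_le_div_iff₀ (by positivity) (by positivity)]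
          nlinarith
      _ ≤ _ := setIntegral_le_integral hint' (Eventually.of_forall fun t => by positivity)
  rw [h5]
  refine (le_max_left M 1).trans (le_trans ?_ h6)
  rw [← hM', inv_mul_eq_div, le_div_iff₀ (by positivity)]
  calc M' * (2 * ε) ≤ M' * (M'⁻¹ * μ.real B) := by gcongr
    _ = μ.real B := by rw [← mul_assoc, mul_inv_cancel₀ hMpos.ne', one_mul]

/-! ### Scalar spectral measures of a normal operator -/

section NormalOperator

variable {H : Type*} [NormedAddCommGroup H] [InnerProductSpace ℂ H] [CompleteSpace H]

/-- A real continuous function regarded as a complex one. -/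
noncomputable def complexify {X : Type*} [TopologicalSpace X] (f : C(X, ℝ)) : C(X, ℂ) :=
  ⟨fun x => (f x : ℂ), by fun_prop⟩

/-- With g = √f one has f = g*g, and the inner product is ‖g(T)ψ‖². -/
theorem inner_cfcHom_nonneg {T : H →L[ℂ] H} (hT : IsStarNormal T) (ψ : H)
    (f : C(spectrum ℂ T, ℝ)) (hf : ∀ x, 0 ≤ f x) :
    0 ≤ (inner ℂ ψ (cfcHom hT (complexify f) ψ)).re := by
  set g : C(spectrum ℂ T, ℂ) := complexify ⟨fun x => Real.sqrt (f x), by fun_prop⟩ with hg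
  have h : complexify f = star g * g := by
    ext x
    simp only [complexify, hg, ContinuousMap.coe_mk, ContinuousMap.mul_apply,
      ContinuousMap.star_apply, RCLike.star_def, Complex.conj_ofReal]
    rw [← Complex.ofReal_mul, Real.mul_self_sqrt (hf x)]
  rw [h, map_mul, map_star, ContinuousLinearMap.star_eq_adjoint]
  change 0 ≤ (inner ℂ ψ (ContinuousLinearMap.adjoint (cfcHom hT g) (cfcHom hT g ψ))).re
  rw [ContinuousLinearMap.adjoint_inner_right]
  exact inner_self_nonneg (𝕜 := ℂ)

theorem conj_inner_cfcHom_complexify {T : H →L[ℂ] H} (hT : IsStarNormal T) (ψ : H)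
    (f : C(spectrum ℂ T, ℝ)) :
    conj (inner ℂ ψ (cfcHom hT (complexify f) ψ)) = inner ℂ ψ (cfcHom hT (complexify f) ψ) := by
  have h : star (complexify f) = complexify f := by
    ext x
    simp [complexify]
  have h2 : star (cfcHom hT (complexify f)) = cfcHom hT (complexify f) := by
    rw [← map_star, h]
  rw [inner_conj_symm]
  conv_lhs => rw [← h2, ContinuousLinearMap.star_eq_adjoint,
    ContinuousLinearMap.adjoint_inner_left]

/-- The functional `f ↦ ⟨ψ, f(T) ψ⟩` is represented by a finite measure on the spectrum. -/
theorem exists_measure_inner_cfcHom {T : H →L[ℂ] H} (hT : IsStarNormal T) (ψ : H) :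
    ∃ ν : Measure (spectrum ℂ T), IsFiniteMeasure ν ∧
      ∀ g : C(spectrum ℂ T, ℂ), inner ℂ ψ (cfcHom hT g ψ) = ∫ x, g x ∂ν := by
  let L : C_c(spectrum ℂ T, ℝ) →ₗ[ℝ] ℝ :=
    { toFun := fun f => (inner ℂ ψ (cfcHom hT (complexify f.toContinuousMap) ψ)).re
      map_add' := fun f g => by
        have : complexify (f + g).toContinuousMap =
            complexify f.toContinuousMap + complexify g.toContinuousMap := by
          ext x
          simp [complexify]
        rw [this, map_add, _root_.add_apply, inner_add_right, Complex.add_re]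
      map_smul' := fun c f => by
        have : complexify (c • f).toContinuousMap = (c : ℂ) • complexify f.toContinuousMap := by
          ext x
          simp [complexify]
        rw [this, map_smul, _root_.smul_apply, inner_smul_right,
          Complex.re_ofReal_mul, RingHom.id_apply, smul_eq_mul] }
  -- Riesz–Markov applies to this positive functional; the spectrum is compact, so compact support
  -- is no restriction.
  let Λ : C_c(spectrum ℂ T, ℝ) →ₚ[ℝ] ℝ :=
    PositiveLinearMap.mk₀ L fun f hf => inner_cfcHom_nonneg hT ψ _ fun x => hf x
  have hreal : ∀ f : C(spectrum ℂ T, ℝ), inner ℂ ψ (cfcHom hT (complexify f) ψ) =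
      ((∫ x, f x ∂(RealRMK.rieszMeasure Λ) : ℝ) : ℂ) := by
    intro f
    have h1 := RealRMK.integral_rieszMeasure Λ (CompactlySupportedContinuousMap.continuousMapEquiv f)
    have h2 : ∫ x, f x ∂(RealRMK.rieszMeasure Λ) =
        (inner ℂ ψ (cfcHom hT (complexify f) ψ)).re := h1
    rw [h2]
    exact (Complex.conj_eq_iff_re.mp (conj_inner_cfcHom_complexify hT ψ f)).symm
  have hfin : IsFiniteMeasure (RealRMK.rieszMeasure Λ) := inferInstance
  refine ⟨RealRMK.rieszMeasure Λ, hfin, fun g => ?_⟩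
  have hg : g = complexify ⟨fun x => (g x).re, by fun_prop⟩ +
      I • complexify ⟨fun x => (g x).im, by fun_prop⟩ := by
    ext x
    simp only [complexify, ContinuousMap.add_apply, ContinuousMap.coe_mk, ContinuousMap.smul_apply,
      smul_eq_mul]
    rw [mul_comm]
    exact (Complex.re_add_im _).symm
  have hint : Integrable g (RealRMK.rieszMeasure Λ) :=
    g.continuous.integrable_of_hasCompactSupport (HasCompactSupport.of_compactSpace g)
  conv_lhs => rw [hg]
  rw [map_add, map_smul, _root_.add_apply, _root_.smul_apply,
    inner_add_right, inner_smul_right, hreal, hreal]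
  have := integral_re_add_im hint
  rw [← this]
  simp only [ContinuousMap.coe_mk]
  rw [mul_comm]
  rfl

end NormalOperator

/-! ### Resolvent families -/

section ResolventFamily

variable {H : Type*} [NormedAddCommGroup H] [InnerProductSpace ℂ H]

/-- The properties of the resolvents of a selfadjoint operator at non-real points. -/
structure IsResolventFamily (R : ℂ → H →L[ℂ] H) : Prop where
  sub_eq : ∀ z w : ℂ, z.im ≠ 0 → w.im ≠ 0 → R z - R w = (z - w) • (R z * R w)
  inner_left : ∀ z : ℂ, z.im ≠ 0 → ∀ x y, inner ℂ (R z x) y = inner ℂ x (R (conj z) y)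
  eq_zero : ∀ z : ℂ, z.im ≠ 0 → ∀ x, R z x = 0 → x = 0

/-- The closed linear span of the vectors `R z φ` with `z` non-real. -/
noncomputable def cyclicSpan (R : ℂ → H →L[ℂ] H) (φ : H) : Submodule ℂ H :=
  (Submodule.span ℂ {x | ∃ z : ℂ, z.im ≠ 0 ∧ x = R z φ}).topologicalClosure

/-- `μ` is the spectral measure of `ψ` for the resolvent family `R`. -/
def IsSpectralMeasureFor (R : ℂ → H →L[ℂ] H) (ψ : H) (μ : Measure ℝ) : Prop :=
  IsFiniteMeasure μ ∧ ∀ z : ℂ, z.im ≠ 0 → inner ℂ ψ (R z ψ) = ∫ x : ℝ, ((x : ℂ) - z)⁻¹ ∂μ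

theorem conj_im_ne {z : ℂ} (hz : z.im ≠ 0) : (conj z).im ≠ 0 := by simpa using hz

namespace IsResolventFamily

variable {R : ℂ → H →L[ℂ] H}

theorem sub_apply (hR : IsResolventFamily R) {z w : ℂ} (hz : z.im ≠ 0) (hw : w.im ≠ 0) (x : H) :
    R z x - R w x = (z - w) • R z (R w x) :=
  congrArg (fun S : H →L[ℂ] H => S x) (hR.sub_eq z w hz hw)

theorem apply_comm (hR : IsResolventFamily R) {z w : ℂ} (hz : z.im ≠ 0) (hw : w.im ≠ 0) (x : H) :
    R z (R w x) = R w (R z x) := by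
  by_cases h : z = w
  · rw [h]
  · have h1 := hR.sub_apply hz hw x
    have h2 := hR.sub_apply hw hz x
    refine smul_right_injective H (sub_ne_zero.mpr h) ?_
    simp only
    rw [← h1, ← neg_sub w z, neg_smul, ← h2, neg_sub]

/-- Pair x with the resolvent identity between z̄ and z. This gives the bound ‖R z‖ ≤ 1/|Im z| and
turns comparisons of norms into comparisons of Stieltjes transforms. -/
theorem im_inner (hR : IsResolventFamily R) {z : ℂ} (hz : z.im ≠ 0) (x : H) :
    (inner ℂ x (R z x)).im = z.im * ‖R z x‖ ^ 2 := by
  have h1 := hR.sub_apply (conj_im_ne hz) hz x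
  have h2 := congrArg (inner ℂ x) h1
  rw [inner_sub_right, inner_smul_right, ← hR.inner_left z hz, ← hR.inner_left z hz,
    inner_self_eq_norm_sq_to_K] at h2
  have h3 : inner ℂ (R z x) x = conj (inner ℂ x (R z x)) := (inner_conj_symm _ _).symm
  rw [h3] at h2
  have h4 := congrArg Complex.im h2
  simp [← Complex.ofReal_pow] at h4
  have h5 := congrArg Complex.im h3
  rw [Complex.conj_im] at h5
  linarith

theorem norm_le (hR : IsResolventFamily R) {z : ℂ} (hz : z.im ≠ 0) : ‖R z‖ ≤ |z.im|⁻¹ := by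
  refine ContinuousLinearMap.opNorm_le_bound _ (by positivity) fun x => ?_
  have hz' : 0 < |z.im| := abs_pos.mpr hz
  rw [inv_mul_eq_div, le_div_iff₀ hz']
  have h1 : |z.im| * ‖R z x‖ ^ 2 ≤ ‖x‖ * ‖R z x‖ := by
    calc |z.im| * ‖R z x‖ ^ 2 = |(inner ℂ x (R z x)).im| := by
          rw [hR.im_inner hz, abs_mul, abs_of_nonneg (sq_nonneg ‖R z x‖)]
      _ ≤ _ := (Complex.abs_im_le_norm _).trans (norm_inner_le_norm _ _)
  rcases (norm_nonneg (R z x)).eq_or_lt with h0 | h0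
  · rw [← h0, zero_mul]
    exact norm_nonneg _
  · refine le_of_mul_le_mul_right ?_ h0
    calc ‖R z x‖ * |z.im| * ‖R z x‖ = |z.im| * ‖R z x‖ ^ 2 := by ring
      _ ≤ _ := h1

theorem tendsto (hR : IsResolventFamily R) {w : ℂ} (hw : w.im ≠ 0) (x : H) :
    Tendsto (fun n : ℕ => R (w + (1 / ((n : ℝ) + 1) : ℝ)) x) atTop (𝓝 (R w x)) :=
  (ContinuousLinearMap.apply ℂ H x).continuous.continuousAt.tendsto.comp
    (tendsto_of_resolvent_identity hR.sub_eq (fun _ hz => hR.norm_le hz) hw)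

theorem apply_mem_cyclicSpan {z : ℂ} (hz : z.im ≠ 0) (φ : H) : R z φ ∈ cyclicSpan R φ :=
  Submodule.le_topologicalClosure _ (Submodule.subset_span ⟨z, hz, rfl⟩)

theorem isClosed_cyclicSpan (φ : H) : IsClosed (cyclicSpan R φ : Set H) :=
  Submodule.isClosed_topologicalClosure _

theorem cyclicSpan_le {φ : H} {V : Submodule ℂ H} (hV : IsClosed (V : Set H))
    (h : ∀ z : ℂ, z.im ≠ 0 → R z φ ∈ V) : cyclicSpan R φ ≤ V := by
  refine Submodule.topologicalClosure_minimal _ (Submodule.span_le.mpr ?_) hV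
  rintro x ⟨z, hz, rfl⟩
  exact h z hz

theorem apply_mem (hR : IsResolventFamily R) {z : ℂ} (hz : z.im ≠ 0) {φ x : H}
    (hx : x ∈ cyclicSpan R φ) : R z x ∈ cyclicSpan R φ := by
  have key : ∀ u w : ℂ, u.im ≠ 0 → w.im ≠ 0 → u ≠ w → R u (R w φ) ∈ cyclicSpan R φ := by
    intro u w hu hw huw
    have h : R u (R w φ) = (u - w)⁻¹ • (R u φ - R w φ) := by
      rw [hR.sub_apply hu hw, smul_smul, inv_mul_cancel₀ (sub_ne_zero.mpr huw), one_smul]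
    rw [h]
    exact Submodule.smul_mem _ _
      (Submodule.sub_mem _ (apply_mem_cyclicSpan hu φ) (apply_mem_cyclicSpan hw φ))
  refine cyclicSpan_le (R := R) (φ := φ) (V := (cyclicSpan R φ).comap (R z).toLinearMap)
    ((isClosed_cyclicSpan φ).preimage (R z).continuous) (fun w hw => ?_) hx
  change R z (R w φ) ∈ cyclicSpan R φ
  by_cases hzw : z = w
  · subst hzw
    refine (isClosed_cyclicSpan φ).mem_of_tendsto (hR.tendsto hz (R z φ))
      (Eventually.of_forall fun n => key _ _ ?_ hz (add_shift_ne z n))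
    rwa [add_shift_im]
  · exact key z w hz hw hzw

theorem apply_mem_orthogonal (hR : IsResolventFamily R) {z : ℂ} (hz : z.im ≠ 0) {φ x : H}
    (hx : x ∈ (cyclicSpan R φ)ᗮ) : R z x ∈ (cyclicSpan R φ)ᗮ := by
  rw [Submodule.mem_orthogonal] at hx ⊢
  intro u hu
  have hc : R (conj z) u ∈ cyclicSpan R φ := hR.apply_mem (conj_im_ne hz) hu
  have h := hR.inner_left (conj z) (conj_im_ne hz) u x
  rw [Complex.conj_conj] at h
  rw [← h]
  exact hx _ hc

/-- Formally the factors are (A - z)(A - w)⁻¹ and (A - w)(A - z)⁻¹. -/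
theorem one_add_mul (hR : IsResolventFamily R) {z w : ℂ} (hz : z.im ≠ 0) (hw : w.im ≠ 0) :
    (1 + (w - z) • R w) * (1 + (z - w) • R z) = 1 := by
  ext x
  have h1 := hR.sub_apply hw hz x
  have h2 : ((1 + (w - z) • R w) * (1 + (z - w) • R z)) x =
      x + (z - w) • R z x + (w - z) • R w (x + (z - w) • R z x) := rfl
  rw [h2, map_add, map_smul, smul_add, smul_comm (w - z) (z - w), ← h1]
  rw [one_apply_eq_self]
  module

theorem isUnit_one_add (hR : IsResolventFamily R) {z w : ℂ} (hz : z.im ≠ 0) (hw : w.im ≠ 0) :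
    IsUnit (1 + (w - z) • R w) :=
  ⟨⟨_, _, hR.one_add_mul hz hw, hR.one_add_mul hw hz⟩, rfl⟩

/-- Otherwise s - R w would be a nonzero multiple of the invertible operator 1 + (w - z) R w. This
is what makes w + 1/s real for nonzero s in the spectrum. -/
theorem one_add_mul_ne_zero_of_mem_spectrum (hR : IsResolventFamily R) {z w : ℂ} (hz : z.im ≠ 0)
    (hw : w.im ≠ 0) {s : ℂ} (hs : s ∈ spectrum ℂ (R w)) : 1 + (w - z) * s ≠ 0 := by
  intro h
  have hzw : w - z ≠ 0 := by
    intro h0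
    simp [h0] at h
  rw [spectrum.mem_iff] at hs
  apply hs
  have h1 : algebraMap ℂ (H →L[ℂ] H) s - R w = (-(w - z)⁻¹) • (1 + (w - z) • R w) := by
    have hs' : s = -(w - z)⁻¹ := by
      field_simp
      linear_combination h
    rw [smul_add, smul_smul, neg_mul, inv_mul_cancel₀ hzw, ← hs', Algebra.algebraMap_eq_smul_one,
      neg_one_smul, sub_eq_add_neg]
  rw [h1]
  have hne : -(w - z)⁻¹ ≠ 0 := neg_ne_zero.mpr (inv_ne_zero hzw)
  exact (hR.isUnit_one_add hz hw).smul (Units.mk0 _ hne)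

variable [CompleteSpace H]

theorem star_eq (hR : IsResolventFamily R) {z : ℂ} (hz : z.im ≠ 0) : star (R z) = R (conj z) := by
  rw [ContinuousLinearMap.star_eq_adjoint, eq_comm, ContinuousLinearMap.eq_adjoint_iff]
  intro x y
  rw [hR.inner_left _ (conj_im_ne hz), Complex.conj_conj]

/-- The component of φ orthogonal to the span is mapped by R i both into the span and into its
complement, hence to 0; injectivity of R i then kills it. -/
theorem mem_cyclicSpan_self (hR : IsResolventFamily R) (φ : H) : φ ∈ cyclicSpan R φ := by
  have : CompleteSpace (cyclicSpan R φ) := (isClosed_cyclicSpan φ).completeSpace_coe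
  obtain ⟨u, hu, v, hv, huv⟩ := (cyclicSpan R φ).exists_add_mem_mem_orthogonal φ
  have hI : (I : ℂ).im ≠ 0 := by simp
  have h1 : R I v = R I φ - R I u := by rw [huv, map_add, add_sub_cancel_left]
  have h2 : R I v ∈ cyclicSpan R φ := by
    rw [h1]
    exact Submodule.sub_mem _ (apply_mem_cyclicSpan hI φ) (hR.apply_mem hI hu)
  have h3 : R I v = 0 := inner_self_eq_zero.mp
    ((Submodule.mem_orthogonal _ _).mp (hR.apply_mem_orthogonal hI hv) _ h2)
  have h4 := hR.eq_zero I hI v h3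
  have h5 : φ = u := by rw [huv, h4, add_zero]
  rwa [← h5] at hu

theorem isStarNormal (hR : IsResolventFamily R) {z : ℂ} (hz : z.im ≠ 0) : IsStarNormal (R z) := by
  constructor
  rw [hR.star_eq hz]
  ext x
  exact hR.apply_comm (conj_im_ne hz) hz x

/-- Every vector has a spectral measure. -/
theorem exists_isSpectralMeasureFor (hR : IsResolventFamily R) (ψ : H) :
    ∃ μ : Measure ℝ, IsSpectralMeasureFor R ψ μ := by
  have hI : (I : ℂ).im ≠ 0 := by simp
  have hT := hR.isStarNormal hI
  obtain ⟨ν, hν, hνint⟩ := exists_measure_inner_cfcHom hT ψ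
  -- The change of variable inverts s = 1/(x - i), which carries the spectrum of R i back to the
  -- real line.
  let X : spectrum ℂ (R I) → ℝ := fun s => (I + (s : ℂ)⁻¹).re
  have hX : Measurable X := by
    refine Complex.measurable_re.comp (measurable_const.add ?_)
    exact measurable_inv.comp measurable_subtype_coe
  have hS : MeasurableSet {s : spectrum ℂ (R I) | (s : ℂ) ≠ 0} :=
    (measurable_subtype_coe (measurableSet_singleton (0 : ℂ))).compl
  have hXval : ∀ s : spectrum ℂ (R I), (s : ℂ) ≠ 0 → (X s : ℂ) = I + (s : ℂ)⁻¹ := by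
    intro s hs
    have him : (I + (s : ℂ)⁻¹).im = 0 := by
      by_contra him
      refine hR.one_add_mul_ne_zero_of_mem_spectrum him hI s.2 ?_
      field_simp
      ring
    exact Complex.ext (by simp [X]) (by rw [him, Complex.ofReal_im])
  -- The point s = 0 corresponds to x = ∞. Discarding it is harmless, since the function g
  -- representing R z vanishes there.
  refine ⟨(ν.restrict {s | (s : ℂ) ≠ 0}).map X, ?_, fun z hz => ?_⟩
  · exact Measure.isFiniteMeasure_map _ _
  have hne : ∀ s : spectrum ℂ (R I), 1 + (I - z) * (s : ℂ) ≠ 0 := fun s =>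
    hR.one_add_mul_ne_zero_of_mem_spectrum hz hI s.2
  let ι : C(spectrum ℂ (R I), ℂ) := (ContinuousMap.id ℂ).restrict (spectrum ℂ (R I))
  -- This is 1/(x - z) expressed in the variable s.
  let g : C(spectrum ℂ (R I), ℂ) := ⟨fun s => (s : ℂ) * (1 + (I - z) * (s : ℂ))⁻¹,
    continuous_subtype_val.mul
      (((continuous_const.mul continuous_subtype_val).const_add 1).inv₀ hne)⟩
  have hι : cfcHom hT ι = R I := cfcHom_id hT
  have hg : g * (1 + (I - z) • ι) = ι := by
    ext s
    have := hne s
    simp only [g, ι, ContinuousMap.mul_apply, ContinuousMap.coe_mk, ContinuousMap.add_apply,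
      ContinuousMap.one_apply, ContinuousMap.smul_apply, smul_eq_mul]
    change (s : ℂ) * (1 + (I - z) * (s : ℂ))⁻¹ * (1 + (I - z) * (s : ℂ)) = s
    rw [mul_assoc, inv_mul_cancel₀ this, mul_one]
  have hgR : cfcHom hT g = R z := by
    have h1 := congrArg (cfcHom hT) hg
    rw [map_mul, map_add, map_smul, map_one, hι] at h1
    have h2 : R z * (1 + (I - z) • R I) = R I := by
      rw [mul_add, mul_one, mul_smul_comm, ← neg_sub z I, neg_smul, ← hR.sub_eq z I hz hI]
      abel
    exact (hR.isUnit_one_add hz hI).mul_right_cancel (h1.trans h2.symm)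
  rw [← hgR, hνint, integral_map hX.aemeasurable
    (continuous_inv_ofReal_sub hz).aestronglyMeasurable]
  have hzero : ∀ s : spectrum ℂ (R I), s ∉ {s : spectrum ℂ (R I) | (s : ℂ) ≠ 0} → g s = 0 := by
    intro s hs
    have hs : (s : ℂ) = 0 := by simpa using hs
    simp [g, hs]
  rw [← setIntegral_eq_integral_of_forall_compl_eq_zero hzero]
  refine setIntegral_congr_fun hS fun s hs => ?_
  have hs : (s : ℂ) ≠ 0 := hs
  simp only [hXval s hs, g, ContinuousMap.coe_mk]
  have h1 : I + (s : ℂ)⁻¹ - z = (1 + (I - z) * (s : ℂ)) * (s : ℂ)⁻¹ := by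
    field_simp
    ring
  rw [h1, mul_inv, inv_inv, mul_comm]


end IsResolventFamily
end ResolventFamily

/-! ### The spectral representation of a cyclic subspace -/

/-- Two families with the same Gram matrix are intertwined by a linear isometry. -/
theorem exists_linearIsometry_of_inner_eq {ι E F : Type*} [NormedAddCommGroup E]
    [InnerProductSpace ℂ E] [NormedAddCommGroup F] [InnerProductSpace ℂ F] [CompleteSpace F]
    (u : ι → E) (v : ι → F) (hu : (Submodule.span ℂ (Set.range u)).topologicalClosure = ⊤)
    (h : ∀ i j, inner ℂ (v i) (v j) = inner ℂ (u i) (u j)) :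
    ∃ W : E →ₗᵢ[ℂ] F, ∀ i, W (u i) = v i := by
  -- Formal combinations avoid the question whether u i ↦ v i is well defined; equality of the Gram
  -- matrices makes the two evaluations have equal norms.
  let e := Finsupp.linearCombination ℂ u
  let f := Finsupp.linearCombination ℂ v
  have hnorm : ∀ c, ‖f c‖ = ‖e c‖ := by
    intro c
    have h1 : inner ℂ (f c) (f c) = inner ℂ (e c) (e c) := by
      simp only [e, f, Finsupp.linearCombination_apply, Finsupp.sum, inner_sum, sum_inner,
        inner_smul_left, inner_smul_right, h]
    rw [inner_self_eq_norm_sq_to_K, inner_self_eq_norm_sq_to_K] at h1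
    have h2 : ‖f c‖ ^ 2 = ‖e c‖ ^ 2 := by exact_mod_cast h1
    exact (sq_eq_sq₀ (norm_nonneg _) (norm_nonneg _)).mp h2
  have hdense : DenseRange e := by
    rw [DenseRange, ← LinearMap.coe_range, Finsupp.range_linearCombination,
      ← Submodule.dense_iff_topologicalClosure_eq_top.symm]
    exact hu
  have hb : ∃ C, ∀ x, ‖f x‖ ≤ C * ‖e x‖ := ⟨1, fun x => by rw [hnorm, one_mul]⟩
  have he : ∀ c, f.extendOfNorm e (e c) = f c := LinearMap.extendOfNorm_eq hdense hb
  refine ⟨⟨(f.extendOfNorm e).toLinearMap, fun x => ?_⟩, fun i => ?_⟩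
  · refine hdense.induction_on (p := fun x => ‖f.extendOfNorm e x‖ = ‖x‖) x
      (isClosed_eq (f.extendOfNorm e).continuous.norm continuous_norm) fun c => ?_
    rw [he, hnorm]
  · have := he (Finsupp.single i 1)
    simpa [e, f] using this

/-- Multiplication by a bounded continuous function on `L²(μ)`. -/
noncomputable def mulLp (μ : Measure ℝ) [IsFiniteMeasure μ] (g : ℝ →ᵇ ℂ) :
    Lp ℂ 2 μ →L[ℂ] Lp ℂ 2 μ :=
  (ContinuousLinearMap.mul ℂ ℂ).holderL μ ⊤ 2 2 (BoundedContinuousFunction.toLp ⊤ μ ℂ g)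

theorem coeFn_mulLp (μ : Measure ℝ) [IsFiniteMeasure μ] (g : ℝ →ᵇ ℂ) (f : Lp ℂ 2 μ) :
    mulLp μ g f =ᵐ[μ] fun x => g x * f x := by
  have h := (ContinuousLinearMap.mul ℂ ℂ).coeFn_holder (r := 2)
    (BoundedContinuousFunction.toLp ⊤ μ ℂ g) f
  filter_upwards [h, BoundedContinuousFunction.coeFn_toLp ⊤ μ ℂ g] with x hx hx'
  change ((ContinuousLinearMap.mul ℂ ℂ).holder 2 (BoundedContinuousFunction.toLp ⊤ μ ℂ g) f :
    Lp ℂ 2 μ) x = _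
  rw [hx, hx']
  rfl

theorem mulLp_toLp (μ : Measure ℝ) [IsFiniteMeasure μ] (g h : ℝ →ᵇ ℂ) :
    mulLp μ g (BoundedContinuousFunction.toLp 2 μ ℂ h) =
      BoundedContinuousFunction.toLp 2 μ ℂ (g * h) := by
  refine Lp.ext ?_
  filter_upwards [coeFn_mulLp μ g (BoundedContinuousFunction.toLp 2 μ ℂ h),
    BoundedContinuousFunction.coeFn_toLp 2 μ ℂ h,
    BoundedContinuousFunction.coeFn_toLp 2 μ ℂ (g * h)] with x h1 h2 h3
  rw [h1, h2, h3]
  rfl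

theorem Lp_induction_kernel {μ : Measure ℝ} [IsFiniteMeasure μ] {V : Submodule ℂ (Lp ℂ 2 μ)}
    (hV : IsClosed (V : Set (Lp ℂ 2 μ))) (h : ∀ z : ℂ, z.im ≠ 0 → kernelLp μ z ∈ V)
    (f : Lp ℂ 2 μ) : f ∈ V := by
  have h1 : (Submodule.span ℂ {f | ∃ z : ℂ, z.im ≠ 0 ∧
      f = kernelLp μ z}).topologicalClosure ≤ V := by
    refine Submodule.topologicalClosure_minimal _ (Submodule.span_le.mpr ?_) hV
    rintro x ⟨z, hz, rfl⟩
    exact h z hz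
  rw [span_kernelLp_dense] at h1
  exact h1 trivial

theorem isFiniteMeasure_withDensity_sq {μ : Measure ℝ} (f : Lp ℂ 2 μ) :
    IsFiniteMeasure (μ.withDensity fun x => ‖f x‖ₑ ^ 2) := by
  refine isFiniteMeasure_withDensity ?_
  have h := lintegral_rpow_enorm_lt_top_of_eLpNorm_lt_top (p := 2) two_ne_zero
    ENNReal.ofNat_ne_top (Lp.memLp f).eLpNorm_lt_top
  refine ne_of_eq_of_ne (lintegral_congr fun x => ?_) h.ne
  rw [ENNReal.toReal_ofNat, ENNReal.rpow_ofNat]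

namespace IsResolventFamily

variable {H : Type*} [NormedAddCommGroup H] [InnerProductSpace ℂ H] {R : ℂ → H →L[ℂ] H}

theorem inner_apply_apply (hR : IsResolventFamily R) {ψ : H} {μ : Measure ℝ}
    (hμ : IsSpectralMeasureFor R ψ μ) {z w : ℂ} (hz : z.im ≠ 0) (hw : w.im ≠ 0) :
    inner ℂ ψ (R z (R w ψ)) = ∫ x : ℝ, (kernelBCF z * kernelBCF w) x ∂μ := by
  have := hμ.1
  have key : ∀ u w : ℂ, u.im ≠ 0 → w.im ≠ 0 → u ≠ w →
      inner ℂ ψ (R u (R w ψ)) = ∫ x : ℝ, (kernelBCF u * kernelBCF w) x ∂μ := by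
    intro u w hu hw huw
    have h1 : R u (R w ψ) = (u - w)⁻¹ • (R u ψ - R w ψ) := by
      rw [hR.sub_apply hu hw, smul_smul, inv_mul_cancel₀ (sub_ne_zero.mpr huw), one_smul]
    have h2 : kernelBCF u * kernelBCF w = (u - w)⁻¹ • (kernelBCF u - kernelBCF w) := by
      rw [kernelBCF_sub hu hw, smul_smul, inv_mul_cancel₀ (sub_ne_zero.mpr huw), one_smul]
    rw [h1, h2, inner_smul_right, inner_sub_right, hμ.2 u hu, hμ.2 w hw, ← integral_kernelBCF hu,
      ← integral_kernelBCF hw, ← integral_sub ((kernelBCF u).integrable μ)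
      ((kernelBCF w).integrable μ), ← integral_const_mul]
    rfl
  by_cases hzw : z = w
  · subst hzw
    refine tendsto_nhds_unique (((innerSL ℂ ψ).continuous.tendsto _).comp
      (hR.tendsto hz (R z ψ))) ?_
    refine (((continuous_integral_boundedContinuousFunction μ).tendsto _).comp
      ((tendsto_kernelBCF hz).mul_const (kernelBCF z))).congr fun n => ?_
    exact (key _ _ (by rwa [add_shift_im]) hz (add_shift_ne z n)).symm
  · exact key z w hz hw hzw

variable [CompleteSpace H]

/-- The spectral representation of the cyclic subspace of `ψ`. -/
theorem exists_linearIsometry (hR : IsResolventFamily R) {ψ : H} {μ : Measure ℝ}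
    [IsFiniteMeasure μ] (hμ : IsSpectralMeasureFor R ψ μ) :
    ∃ W : Lp ℂ 2 μ →ₗᵢ[ℂ] H, ∀ z : ℂ, z.im ≠ 0 → W (kernelLp μ z) = R z ψ := by
  obtain ⟨W, hW⟩ := exists_linearIsometry_of_inner_eq
    (fun z : {z : ℂ // z.im ≠ 0} => kernelLp μ z) (fun z => R z ψ) (by
      rw [← span_kernelLp_dense μ]
      congr 2
      ext f
      simp [eq_comm]) (by
      rintro ⟨z, hz⟩ ⟨w, hw⟩
      have hz' := conj_im_ne hz
      rw [inner_kernelLp μ hz, hR.inner_left z hz, hR.inner_apply_apply hμ hz' hw]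
      refine integral_congr_ae ?_
      filter_upwards [coeFn_kernelLp μ hw] with x hx
      rw [hx, BoundedContinuousFunction.coe_mul, Pi.mul_apply, kernelBCF_apply hz',
        kernelBCF_apply hw, mul_comm])
  exact ⟨W, fun z hz => hW ⟨z, hz⟩⟩

end IsResolventFamily

/-- `W` is the spectral representation of the cyclic subspace of `ψ`. -/
structure IsSpectralRepresentation {H : Type*} [NormedAddCommGroup H] [InnerProductSpace ℂ H]
    (R : ℂ → H →L[ℂ] H) (ψ : H) (μ : Measure ℝ) [IsFiniteMeasure μ]
    (W : Lp ℂ 2 μ →ₗᵢ[ℂ] H) : Prop where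
  family : IsResolventFamily R
  apply_kernel : ∀ z : ℂ, z.im ≠ 0 → W (kernelLp μ z) = R z ψ

namespace IsSpectralRepresentation

variable {H : Type*} [NormedAddCommGroup H] [InnerProductSpace ℂ H]
  {R : ℂ → H →L[ℂ] H} {ψ : H} {μ : Measure ℝ} [IsFiniteMeasure μ] {W : Lp ℂ 2 μ →ₗᵢ[ℂ] H}

theorem apply_mem (hW : IsSpectralRepresentation R ψ μ W) (f : Lp ℂ 2 μ) :
    W f ∈ cyclicSpan R ψ := by
  refine Lp_induction_kernel (V := (cyclicSpan R ψ).comap W.toLinearMap)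
    ((IsResolventFamily.isClosed_cyclicSpan ψ).preimage W.continuous) (fun z hz => ?_) f
  change W (kernelLp μ z) ∈ cyclicSpan R ψ
  rw [hW.apply_kernel z hz]
  exact IsResolventFamily.apply_mem_cyclicSpan hz ψ

theorem exists_eq (hW : IsSpectralRepresentation R ψ μ W) {v : H} (hv : v ∈ cyclicSpan R ψ) :
    ∃ f, W f = v := by
  have hc : IsClosed ((LinearMap.range W.toLinearMap : Submodule ℂ H) : Set H) :=
    W.isometry.isClosedEmbedding.isClosed_range
  exact IsResolventFamily.cyclicSpan_le hc (fun z hz => ⟨_, hW.apply_kernel z hz⟩) hv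

/-- Both sides are continuous in f, so kernels suffice; there the resolvent identity for R matches
the one for the kernels. -/
theorem apply_mulLp (hW : IsSpectralRepresentation R ψ μ W) {z : ℂ} (hz : z.im ≠ 0)
    (f : Lp ℂ 2 μ) : R z (W f) = W (mulLp μ (kernelBCF z) f) := by
  have hR := hW.family
  let T : Lp ℂ 2 μ →L[ℂ] H := (R z).comp W.toContinuousLinearMap -
    W.toContinuousLinearMap.comp (mulLp μ (kernelBCF z))
  suffices hT : f ∈ LinearMap.ker T.toLinearMap from sub_eq_zero.mp hT
  refine Lp_induction_kernel T.isClosed_ker (fun w hw => ?_) f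
  change R z (W (kernelLp μ w)) - W (mulLp μ (kernelBCF z) (kernelLp μ w)) = 0
  rw [sub_eq_zero, hW.apply_kernel w hw, kernelLp, mulLp_toLp]
  have key : ∀ u w : ℂ, u.im ≠ 0 → w.im ≠ 0 → u ≠ w → R u (R w ψ) =
      W (BoundedContinuousFunction.toLp 2 μ ℂ (kernelBCF u * kernelBCF w)) := by
    intro u w hu hw huw
    have h1 : R u (R w ψ) = (u - w)⁻¹ • (R u ψ - R w ψ) := by
      rw [hR.sub_apply hu hw, smul_smul, inv_mul_cancel₀ (sub_ne_zero.mpr huw), one_smul]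
    have h2 : kernelBCF u * kernelBCF w = (u - w)⁻¹ • (kernelBCF u - kernelBCF w) := by
      rw [kernelBCF_sub hu hw, smul_smul, inv_mul_cancel₀ (sub_ne_zero.mpr huw), one_smul]
    rw [h1, h2, map_smul, map_smul, map_sub, map_sub, ← hW.apply_kernel u hu,
      ← hW.apply_kernel w hw]
    rfl
  by_cases hzw : z = w
  · subst hzw
    refine tendsto_nhds_unique (hR.tendsto hz (R z ψ)) ?_
    refine (((W.continuous.comp (BoundedContinuousFunction.toLp 2 μ ℂ).continuous).tendsto _).comp
      ((tendsto_kernelBCF hz).mul_const (kernelBCF z))).congr fun n => ?_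
    exact (key _ _ (by rwa [add_shift_im]) hz (add_shift_ne z n)).symm
  · exact key z w hz hw hzw

theorem inner_apply (hW : IsSpectralRepresentation R ψ μ W) {z : ℂ} (hz : z.im ≠ 0)
    (f g : Lp ℂ 2 μ) :
    inner ℂ (W f) (R z (W g)) = ∫ x : ℝ, conj (f x) * g x * ((x : ℂ) - z)⁻¹ ∂μ := by
  rw [hW.apply_mulLp hz, W.inner_map_map, L2.inner_def]
  refine integral_congr_ae ?_
  filter_upwards [coeFn_mulLp μ (kernelBCF z) g] with x hx
  rw [hx, kernelBCF_apply hz, RCLike.inner_apply]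
  ring

theorem inner_apply_self (hW : IsSpectralRepresentation R ψ μ W) {z : ℂ} (hz : z.im ≠ 0)
    (f : Lp ℂ 2 μ) :
    inner ℂ (W f) (R z (W f)) =
      ∫ x : ℝ, ((x : ℂ) - z)⁻¹ ∂(μ.withDensity fun x => ‖f x‖ₑ ^ 2) := by
  have hm : AEMeasurable (fun x => ‖f x‖ₑ ^ 2) μ := (Lp.aestronglyMeasurable f).enorm.pow_const 2
  have hfin : ∀ x, ‖f x‖ₑ ^ 2 < ⊤ := fun x => ENNReal.pow_lt_top enorm_lt_top
  rw [hW.inner_apply hz, integral_withDensity_eq_integral_toReal_smul₀ hm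
    (Eventually.of_forall hfin)]
  refine integral_congr_ae (Eventually.of_forall fun x => ?_)
  simp only [ENNReal.toReal_pow, toReal_enorm, Complex.real_smul]
  rw [mul_comm (conj (f x)), Complex.mul_conj, Complex.normSq_eq_norm_sq]

theorem isSpectralMeasureFor (hW : IsSpectralRepresentation R ψ μ W) (f : Lp ℂ 2 μ) :
    IsSpectralMeasureFor R (W f) (μ.withDensity fun x => ‖f x‖ₑ ^ 2) :=
  ⟨isFiniteMeasure_withDensity_sq f, fun _ hz => hW.inner_apply_self hz f⟩

end IsSpectralRepresentation

/-! ### Two orthogonal cyclic subspaces with disjoint singular parts -/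

theorem mutuallySingular_restrict_of_null {α : Type*} [MeasurableSpace α] (μ : Measure α)
    {ν : Measure α} {S : Set α} (hS : MeasurableSet S) (h : ν S = 0) : μ.restrict S ⟂ₘ ν :=
  ⟨Sᶜ, hS.compl, by rw [Measure.restrict_apply hS.compl, Set.compl_inter_self, measure_empty],
    by rwa [compl_compl]⟩

/-- If the singular part of `μ` is carried by `S` and `|f|² μ` is singular, then `f` vanishes
outside of `S`. -/
theorem ae_eq_zero_of_singular_withDensity {μ : Measure ℝ} [IsFiniteMeasure μ] {f : Lp ℂ 2 μ}
    {S Q : Set ℝ} (hS : μ.singularPart volume Sᶜ = 0) (hQm : MeasurableSet Q)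
    (hQ : μ.withDensity (fun x => ‖f x‖ₑ ^ 2) Q = 0) (hQc : volume Qᶜ = 0) :
    ∀ᵐ x ∂μ, x ∉ S → f x = 0 := by
  have hm : AEMeasurable (fun x => ‖f x‖ₑ ^ 2) μ := (Lp.aestronglyMeasurable f).enorm.pow_const 2
  have h1 : ∀ᵐ x ∂μ, x ∈ Q → f x = 0 := by
    rw [withDensity_apply _ hQm, lintegral_eq_zero_iff' hm.restrict,
      EventuallyEq, ae_restrict_iff' hQm] at hQ
    filter_upwards [hQ] with x hx hxQ
    simpa using hx hxQ
  -- The singular part of μ does not charge the complement of S, and the absolutely continuous part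
  -- does not charge the Lebesgue null set Qᶜ.
  have h2 : μ (Qᶜ ∩ Sᶜ) = 0 := by
    have h3 := μ.singularPart_add_rnDeriv volume
    rw [← h3, Measure.add_apply, add_eq_zero]
    exact ⟨measure_mono_null Set.inter_subset_right hS,
      withDensity_absolutelyContinuous _ _ (measure_mono_null Set.inter_subset_left hQc)⟩
  have h3 : ∀ᵐ x ∂μ, x ∉ Qᶜ ∩ Sᶜ := measure_eq_zero_iff_ae_notMem.mp h2
  filter_upwards [h1, h3] with x hx1 hx2 hxS
  by_cases hxQ : x ∈ Q
  · exact hx1 hxQ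
  · exact absurd ⟨hxQ, hxS⟩ hx2

/-- The vectors with singular spectral measure. -/
def singularVectors {H : Type*} [NormedAddCommGroup H] [InnerProductSpace ℂ H]
    (R : ℂ → H →L[ℂ] H) : Set H :=
  {ψ | ∃ μ : Measure ℝ, IsSpectralMeasureFor R ψ μ ∧ μ ⟂ₘ volume}

theorem inner_eq_zero_of_disjoint_supports {μ : Measure ℝ} {f g : Lp ℂ 2 μ} {S : Set ℝ}
    (hf : ∀ᵐ x ∂μ, x ∈ S → f x = 0) (hg : ∀ᵐ x ∂μ, x ∉ S → g x = 0) : inner ℂ f g = 0 := by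
  rw [L2.inner_def, ← integral_zero ℝ ℂ (μ := μ)]
  refine integral_congr_ae ?_
  filter_upwards [hf, hg] with x h1 h2
  by_cases hx : x ∈ S
  · rw [h1 hx, inner_zero_left]
  · rw [h2 hx, inner_zero_right]

section Pair

variable {H : Type*} [NormedAddCommGroup H] [InnerProductSpace ℂ H]
  {R : ℂ → H →L[ℂ] H} {φ χ : H} {μ ν : Measure ℝ} [IsFiniteMeasure μ] [IsFiniteMeasure ν]

theorem IsSpectralRepresentation.inner_add {W₁ : Lp ℂ 2 μ →ₗᵢ[ℂ] H} {W₂ : Lp ℂ 2 ν →ₗᵢ[ℂ] H}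
    (h₁ : IsSpectralRepresentation R φ μ W₁) (h₂ : IsSpectralRepresentation R χ ν W₂)
    (horth : ∀ u ∈ cyclicSpan R φ, ∀ v ∈ cyclicSpan R χ, inner ℂ u v = 0)
    {z : ℂ} (hz : z.im ≠ 0) (f₁ g₁ : Lp ℂ 2 μ) (f₂ g₂ : Lp ℂ 2 ν) :
    inner ℂ (W₁ f₁ + W₂ f₂) (R z (W₁ g₁ + W₂ g₂)) =
      ∫ x : ℝ, conj (f₁ x) * g₁ x * ((x : ℂ) - z)⁻¹ ∂μ +
      ∫ x : ℝ, conj (f₂ x) * g₂ x * ((x : ℂ) - z)⁻¹ ∂ν := by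
  have hc₁ : inner ℂ (W₁ f₁) (R z (W₂ g₂)) = 0 :=
    horth _ (h₁.apply_mem f₁) _ (h₁.family.apply_mem hz (h₂.apply_mem g₂))
  have hc₂ : inner ℂ (W₂ f₂) (R z (W₁ g₁)) = 0 :=
    inner_eq_zero_symm.mp
      (horth _ (h₁.family.apply_mem hz (h₁.apply_mem g₁)) _ (h₂.apply_mem f₂))
  rw [map_add, inner_add_left, inner_add_right, inner_add_right, hc₁, hc₂, h₁.inner_apply hz,
    h₂.inner_apply hz, add_zero, zero_add]

theorem integral_conj_mul_indicatorConstLp {S : Set ℝ} (hS : MeasurableSet S) (f : Lp ℂ 2 μ)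
    (k : ℝ → ℂ) :
    ∫ x, conj (f x) * (indicatorConstLp 2 hS (measure_ne_top μ S) (1 : ℂ)) x * k x ∂μ =
      ∫ x in S, conj (f x) * k x ∂μ := by
  rw [← integral_indicator hS]
  refine integral_congr_ae ?_
  filter_upwards [indicatorConstLp_coeFn (p := 2) (hs := hS) (hμs := measure_ne_top μ S)
    (c := (1 : ℂ))] with x hx
  rw [hx]
  by_cases hxS : x ∈ S <;> simp [hxS]

theorem integral_conj_indicatorConstLp_mul {S : Set ℝ} (hS : MeasurableSet S) (k : ℝ → ℂ) :
    ∫ x, conj ((indicatorConstLp 2 hS (measure_ne_top μ S) (1 : ℂ)) x) *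
      (indicatorConstLp 2 hS (measure_ne_top μ S) (1 : ℂ)) x * k x ∂μ = ∫ x in S, k x ∂μ := by
  rw [← integral_indicator hS]
  refine integral_congr_ae ?_
  filter_upwards [indicatorConstLp_coeFn (p := 2) (hs := hS) (hμs := measure_ne_top μ S)
    (c := (1 : ℂ))] with x hx
  rw [hx]
  by_cases hxS : x ∈ S <;> simp [hxS]

variable [CompleteSpace H]

theorem exists_add_eq_of_orthogonal_cyclicSpans
    (horth : ∀ u ∈ cyclicSpan R φ, ∀ v ∈ cyclicSpan R χ, inner ℂ u v = 0)
    (hspan : ∀ v ∈ (cyclicSpan R φ)ᗮ, v ∈ (cyclicSpan R χ)ᗮ → v = 0) (v : H) :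
    ∃ a ∈ cyclicSpan R φ, ∃ b ∈ cyclicSpan R χ, a + b = v := by
  have : CompleteSpace (cyclicSpan R φ) :=
    (IsResolventFamily.isClosed_cyclicSpan φ).completeSpace_coe
  have : CompleteSpace (cyclicSpan R χ) :=
    (IsResolventFamily.isClosed_cyclicSpan χ).completeSpace_coe
  obtain ⟨a, ha, a', ha', hv⟩ := (cyclicSpan R φ).exists_add_mem_mem_orthogonal v
  obtain ⟨b, hb, b', hb', ha2⟩ := (cyclicSpan R χ).exists_add_mem_mem_orthogonal a'
  have hbφ : b ∈ (cyclicSpan R φ)ᗮ := fun u hu => horth u hu b hb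
  have hb0 : b' = 0 := by
    refine hspan b' ?_ hb'
    have : b' = a' - b := by rw [ha2, add_sub_cancel_left]
    rw [this]
    exact Submodule.sub_mem _ ha' hbφ
  exact ⟨a, ha, b, hb, by rw [hv, ha2, hb0, add_zero]⟩

/-- If `φ` and `χ` generate orthogonal cyclic subspaces that together span the whole space, and
the singular parts of their spectral measures are carried by disjoint null sets, then the singular
subspace is cyclic. -/
theorem IsResolventFamily.exists_cyclicSpan_eq_singularVectors (hR : IsResolventFamily R)
    (hμ : IsSpectralMeasureFor R φ μ) (hν : IsSpectralMeasureFor R χ ν)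
    (horth : ∀ u ∈ cyclicSpan R φ, ∀ v ∈ cyclicSpan R χ, inner ℂ u v = 0)
    (hspan : ∀ v ∈ (cyclicSpan R φ)ᗮ, v ∈ (cyclicSpan R χ)ᗮ → v = 0)
    {S T : Set ℝ} (hS : MeasurableSet S) (hT : MeasurableSet T) (hST : Disjoint S T)
    (hS0 : volume S = 0) (hT0 : volume T = 0) (hSμ : μ.singularPart volume Sᶜ = 0)
    (hTν : ν.singularPart volume Tᶜ = 0) :
    ∃ ψ ∈ singularVectors R, (cyclicSpan R ψ : Set H) = singularVectors R := by
  obtain ⟨W₁, hW₁⟩ := hR.exists_linearIsometry hμ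
  obtain ⟨W₂, hW₂⟩ := hR.exists_linearIsometry hν
  have h₁ : IsSpectralRepresentation R φ μ W₁ := ⟨hR, hW₁⟩
  have h₂ : IsSpectralRepresentation R χ ν W₂ := ⟨hR, hW₂⟩
  have hrep : ∀ v : H, ∃ f g, v = W₁ f + W₂ g := by
    intro v
    obtain ⟨a, ha, b, hb, rfl⟩ := exists_add_eq_of_orthogonal_cyclicSpans horth hspan v
    obtain ⟨f, rfl⟩ := h₁.exists_eq ha
    obtain ⟨g, rfl⟩ := h₂.exists_eq hb
    exact ⟨f, g, rfl⟩
  -- The cyclic vector will be 1_S ⊕ 1_T, with spectral measure m = μ|S + ν|T.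
  set a : Lp ℂ 2 μ := indicatorConstLp 2 hS (measure_ne_top μ S) (1 : ℂ) with ha
  set b : Lp ℂ 2 ν := indicatorConstLp 2 hT (measure_ne_top ν T) (1 : ℂ) with hb
  set m : Measure ℝ := μ.restrict S + ν.restrict T with hm
  have hkint : ∀ (ρ : Measure ℝ) [IsFiniteMeasure ρ] {z : ℂ}, z.im ≠ 0 →
      Integrable (fun x : ℝ => ((x : ℂ) - z)⁻¹) ρ := fun ρ _ z hz => by
    simpa using integrable_mul_kernel (integrable_const (μ := ρ) (1 : ℂ)) hz
  have hψ : IsSpectralMeasureFor R (W₁ a + W₂ b) m := by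
    refine ⟨inferInstance, fun z hz => ?_⟩
    rw [h₁.inner_add h₂ horth hz, integral_conj_indicatorConstLp_mul hS,
      integral_conj_indicatorConstLp_mul hT, hm, integral_add_measure (hkint _ hz) (hkint _ hz)]
  have hmsing : m ⟂ₘ volume := (mutuallySingular_restrict_of_null μ hS hS0).add_left
    (mutuallySingular_restrict_of_null ν hT hT0)
  refine ⟨W₁ a + W₂ b, ⟨m, hψ, hmsing⟩, Set.Subset.antisymm ?_ ?_⟩
  -- Vectors of the cyclic subspace have spectral measures with a density with respect to m, which
  -- is singular.
  · intro v hv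
    obtain ⟨W, hW⟩ := hR.exists_linearIsometry hψ
    have h : IsSpectralRepresentation R _ m W := ⟨hR, hW⟩
    obtain ⟨f, rfl⟩ := h.exists_eq hv
    exact ⟨_, h.isSpectralMeasureFor f,
      hmsing.mono_ac (withDensity_absolutelyContinuous _ _) Measure.AbsolutelyContinuous.rfl⟩
  · rintro v ⟨ρ, hρ, hρsing⟩
    obtain ⟨f, g, rfl⟩ := hrep v
    have hρeq : ρ = μ.withDensity (fun x => ‖f x‖ₑ ^ 2) + ν.withDensity (fun x => ‖g x‖ₑ ^ 2) := by
      have := hρ.1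
      have := isFiniteMeasure_withDensity_sq f
      have := isFiniteMeasure_withDensity_sq g
      refine measure_ext_of_stieltjes fun z hz => ?_
      rw [← hρ.2 z hz, h₁.inner_add h₂ horth hz, integral_add_measure (hkint _ hz) (hkint _ hz),
        ← h₁.inner_apply_self hz, ← h₂.inner_apply_self hz, h₁.inner_apply hz, h₂.inner_apply hz]
    obtain ⟨Q, hQm, hQ, hQc⟩ := hρsing
    rw [hρeq, Measure.add_apply, add_eq_zero] at hQ
    have hf := ae_eq_zero_of_singular_withDensity hSμ hQm hQ.1 hQc
    have hg := ae_eq_zero_of_singular_withDensity hTν hQm hQ.2 hQc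
    have hcomp : CompleteSpace (cyclicSpan R (W₁ a + W₂ b)) :=
      (isClosed_cyclicSpan _).completeSpace_coe
    change W₁ f + W₂ g ∈ cyclicSpan R (W₁ a + W₂ b)
    -- It suffices that every u orthogonal to the cyclic subspace is orthogonal to the given
    -- singular vector.
    rw [← Submodule.orthogonal_orthogonal (cyclicSpan R (W₁ a + W₂ b))]
    intro u hu
    obtain ⟨p, q, rfl⟩ := hrep u
    have hpint : Integrable (fun x => conj (p x)) μ :=
      (RCLike.conjCLE (K := ℂ)).toContinuousLinearMap.integrable_comp (integrable_of_Lp_two p)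
    have hqint : Integrable (fun x => conj (q x)) ν :=
      (RCLike.conjCLE (K := ℂ)).toContinuousLinearMap.integrable_comp (integrable_of_Lp_two q)
    -- Disjointness of S and T glues the two components of u into one density against m. Its
    -- transform is ⟨u, R z ψ⟩ = 0 for the cyclic vector ψ, so p vanishes on S and q on T.
    let r : ℝ → ℂ := fun x =>
      S.indicator (fun x => conj (p x)) x + T.indicator (fun x => conj (q x)) x
    have hrS : ∀ x ∈ S, r x = conj (p x) := fun x hx => by
      simp [r, hx, Set.disjoint_left.mp hST hx]
    have hrT : ∀ x ∈ T, r x = conj (q x) := fun x hx => by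
      simp [r, hx, Set.disjoint_right.mp hST hx]
    have hr₁ : Integrable r (μ.restrict S) :=
      hpint.restrict.congr
        ((ae_restrict_iff' hS).mpr (Eventually.of_forall fun x hx => (hrS x hx).symm))
    have hr₂ : Integrable r (ν.restrict T) :=
      hqint.restrict.congr
        ((ae_restrict_iff' hT).mpr (Eventually.of_forall fun x hx => (hrT x hx).symm))
    have hr : r =ᵐ[m] 0 := by
      refine ae_eq_zero_of_stieltjes (hr₁.add_measure hr₂) fun z hz => ?_
      have h0 : inner ℂ (W₁ p + W₂ q) (R z (W₁ a + W₂ b)) = 0 :=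
        inner_eq_zero_symm.mp
          ((Submodule.mem_orthogonal _ _).mp hu _ (apply_mem_cyclicSpan hz _))
      rw [h₁.inner_add h₂ horth hz, integral_conj_mul_indicatorConstLp hS,
        integral_conj_mul_indicatorConstLp hT] at h0
      rw [hm, integral_add_measure (integrable_mul_kernel hr₁ hz) (integrable_mul_kernel hr₂ hz),
        ← h0]
      congr 1
      · exact setIntegral_congr_fun hS fun x hx => by simp only [hrS x hx]
      · exact setIntegral_congr_fun hT fun x hx => by simp only [hrT x hx]
    rw [hm, EventuallyEq, ae_add_measure_iff, ae_restrict_iff' hS, ae_restrict_iff' hT] at hr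
    have hp : ∀ᵐ x ∂μ, x ∈ S → p x = 0 := by
      filter_upwards [hr.1] with x hx hxS
      have := hx hxS
      rw [hrS x hxS] at this
      simpa using this
    have hq : ∀ᵐ x ∂ν, x ∈ T → q x = 0 := by
      filter_upwards [hr.2] with x hx hxT
      have := hx hxT
      rw [hrT x hxT] at this
      simpa using this
    rw [inner_add_left, inner_add_right, inner_add_right, W₁.inner_map_map, W₂.inner_map_map,
      horth _ (h₁.apply_mem p) _ (h₂.apply_mem g),
      inner_eq_zero_symm.mp (horth _ (h₁.apply_mem f) _ (h₂.apply_mem q)),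
      inner_eq_zero_of_disjoint_supports hp hf, inner_eq_zero_of_disjoint_supports hq hg]
    simp

end Pair

/-! ### Rank one perturbations -/

/-- Two resolvent families whose values at `i` differ by the rank one operator `⟨φ, ·⟩ η`. -/
structure IsRankOnePair {H : Type*} [NormedAddCommGroup H] [InnerProductSpace ℂ H]
    (R R' : ℂ → H →L[ℂ] H) (φ η : H) : Prop where
  left : IsResolventFamily R
  right : IsResolventFamily R'
  ne_zero_left : φ ≠ 0
  ne_zero_right : η ≠ 0
  sub_apply : ∀ y, R I y - R' I y = inner ℂ φ y • η

theorem I_im_ne : (I : ℂ).im ≠ 0 := by simp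

/-! ### The Cayley transform U = 1 + 2i R(i) -/

section Cayley

variable {H : Type*} [NormedAddCommGroup H] [InnerProductSpace ℂ H] {R : ℂ → H →L[ℂ] H}

/-- The Cayley transform preserves inner products. -/
theorem IsResolventFamily.inner_cayley (hR : IsResolventFamily R) (x y : H) :
    inner ℂ (x + (2 * I) • R I x) (y + (2 * I) • R I y) = inner ℂ x y := by
  have hI' : (-I : ℂ).im ≠ 0 := by simp
  have h1 : inner ℂ (R I x) y = inner ℂ x (R (-I) y) := by
    rw [hR.inner_left I I_im_ne, Complex.conj_I]
  have h2 : inner ℂ (R I x) (R I y) = inner ℂ x (R (-I) (R I y)) := by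
    rw [hR.inner_left I I_im_ne, Complex.conj_I]
  have h3 := congrArg (inner ℂ x) (hR.sub_apply hI' I_im_ne y)
  rw [inner_sub_right, inner_smul_right] at h3
  simp only [inner_add_left, inner_add_right, inner_smul_left, inner_smul_right, h1, h2, map_mul,
    Complex.conj_I, Complex.conj_ofNat]
  linear_combination (-2 * I) * h3

/-- The inverse of the Cayley transform is 1 - 2i R(-i). -/
theorem IsResolventFamily.exists_cayley_eq (hR : IsResolventFamily R) (y : H) :
    ∃ x, x + (2 * I) • R I x = y := by
  have hI' : (-I : ℂ).im ≠ 0 := by simp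
  refine ⟨y - (2 * I) • R (-I) y, ?_⟩
  have h := hR.sub_apply I_im_ne hI' y
  have h2 : I - -I = 2 * I := by ring
  rw [h2] at h
  rw [map_sub, map_smul, ← h]
  module

end Cayley

namespace IsRankOnePair

variable {H : Type*} [NormedAddCommGroup H] [InnerProductSpace ℂ H]
  {R R' : ℂ → H →L[ℂ] H} {φ η : H}

theorem symm (h : IsRankOnePair R R' φ η) : IsRankOnePair R' R φ (-η) where
  left := h.right
  right := h.left
  ne_zero_left := h.ne_zero_left
  ne_zero_right := neg_ne_zero.mpr h.ne_zero_right
  sub_apply y := by rw [smul_neg, ← h.sub_apply, neg_sub]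

/-- The difference of the resolvents at an arbitrary non-real point. -/
theorem resolvent_sub (h : IsRankOnePair R R' φ η) {z : ℂ} (hz : z.im ≠ 0) (y : H) :
    R z y - R' z y = inner ℂ φ (y + (z - I) • R' z y) • (η + (z - I) • R z η) := by
  -- With V = 1 + (z - i)R(z) and V' = 1 + (z - i)R'(z) one has R(z) = V R(i) and R'(z) = R'(i) V'.
  -- The difference of the resolvents is then V (R(i) - R'(i)) V'.
  set c := y + (z - I) • R' z y with hc
  have h1 : R' I c = R' z y := by
    have := h.right.sub_apply I_im_ne hz y
    rw [hc, map_add, map_smul, ← neg_sub I z, neg_smul, ← this]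
    abel
  have h2 : ∀ x, R I x + (z - I) • R z (R I x) = R z x := by
    intro x
    rw [← h.left.sub_apply hz I_im_ne x]
    abel
  have h3 : inner ℂ φ c • (η + (z - I) • R z η) =
      (R I c - R' I c) + (z - I) • R z (R I c - R' I c) := by
    rw [h.sub_apply, map_smul, smul_add, smul_comm (z - I)]
  rw [h3, map_sub, h1]
  have h4 := h2 c
  have h5 : R z c = R z y + (z - I) • R z (R' z y) := by rw [hc, map_add, map_smul]
  rw [h5] at h4
  rw [smul_sub, eq_sub_of_add_eq h4.symm]
  abel

/-- The Cayley transforms U and U' agree on φ^⊥, and both preserve inner products. For x ⊥ φ, Ux is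
therefore orthogonal to both Uφ and U'φ, hence to η, which is a nonzero multiple of their
difference. So U⁻¹η is orthogonal to φ^⊥, that is, a multiple of φ. -/
theorem exists_eq_smul_cayley (h : IsRankOnePair R R' φ η) :
    ∃ κ : ℂ, κ ≠ 0 ∧ η = κ • (φ + (2 * I) • R I φ) := by
  obtain ⟨w, hw⟩ := h.left.exists_cayley_eq η
  have hw' : w ∈ (Submodule.span ℂ {φ})ᗮᗮ := by
    rw [Submodule.mem_orthogonal']
    intro x hx
    have hx : inner ℂ φ x = 0 := Submodule.mem_orthogonal_singleton_iff_inner_right.mp hx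
    have h0 := h.sub_apply x
    rw [hx, zero_smul, sub_eq_zero] at h0
    have h1 := h.right.inner_cayley φ x
    rw [← h0, hx] at h1
    have h2 := h.left.inner_cayley φ x
    rw [hx] at h2
    have h3 : R' I φ = R I φ - inner ℂ φ φ • η := by rw [← h.sub_apply]; abel
    have h4 : φ + (2 * I) • R' I φ = (φ + (2 * I) • R I φ) - (2 * I * inner ℂ φ φ) • η := by
      rw [h3]
      module
    rw [h4, inner_sub_left, h2, inner_smul_left, zero_sub, neg_eq_zero, mul_eq_zero] at h1
    have hne : conj (2 * I * inner ℂ φ φ) ≠ 0 := by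
      simpa using h.ne_zero_left
    have h5 := h1.resolve_left hne
    rwa [← hw, h.left.inner_cayley] at h5
  rw [Submodule.orthogonal_orthogonal] at hw'
  obtain ⟨κ, rfl⟩ := Submodule.mem_span_singleton.mp hw'
  have hη : η = κ • (φ + (2 * I) • R I φ) := by
    rw [← hw, map_smul]
    module
  refine ⟨κ, ?_, hη⟩
  rintro rfl
  rw [zero_smul] at hη
  exact h.ne_zero_right hη

/-- The Aronszajn–Krein relation. -/
theorem exists_aronszajn_krein (h : IsRankOnePair R R' φ η) :
    ∃ κ : ℂ, κ ≠ 0 ∧ ∀ z : ℂ, z.im ≠ 0 →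
      inner ℂ φ (R z φ) - inner ℂ φ (R' z φ) =
        κ * (inner ℂ φ φ + (z - I) * inner ℂ φ (R' z φ)) *
          (inner ℂ φ φ + (z + I) * inner ℂ φ (R z φ)) := by
  obtain ⟨κ, hκ, hη⟩ := h.exists_eq_smul_cayley
  refine ⟨κ, hκ, fun z hz => ?_⟩
  have h1 := congrArg (inner ℂ φ) (h.resolvent_sub hz φ)
  -- Formally (A - i)(A - z)⁻¹ · (A + i)(A - i)⁻¹ = (A + i)(A - z)⁻¹.
  have h2 : η + (z - I) • R z η = κ • (φ + (z + I) • R z φ) := by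
    have h3 := h.left.sub_apply hz I_im_ne φ
    rw [hη, map_smul, map_add, map_smul]
    have h4 : κ • (φ + (2 * I) • R I φ) + (z - I) • κ • (R z φ + (2 * I) • R z (R I φ)) =
        κ • (φ + (2 * I) • R I φ + (z - I) • R z φ + (2 * I) • ((z - I) • R z (R I φ))) := by
      module
    rw [h4, ← h3]
    module
  rw [h2, inner_sub_right, inner_smul_right, inner_smul_right, inner_add_right, inner_add_right,
    inner_smul_right, inner_smul_right] at h1
  rw [h1]
  ring

/-- The two Borel transforms of `φ` do not blow up at the same point. -/
theorem not_tendsto_both (h : IsRankOnePair R R' φ η) (x : ℝ)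
    (h₁ : Tendsto (fun ε : ℝ => (inner ℂ φ (R (x + ε * I) φ)).im) (𝓝[>] 0) atTop)
    (h₂ : Tendsto (fun ε : ℝ => (inner ℂ φ (R' (x + ε * I) φ)).im) (𝓝[>] 0) atTop) : False := by
  obtain ⟨κ, hκ, hrel⟩ := h.exists_aronszajn_krein
  have hinv : ∀ f : ℝ → ℂ, Tendsto (fun ε => (f ε).im) (𝓝[>] 0) atTop →
      Tendsto (fun ε => (f ε)⁻¹) (𝓝[>] 0) (𝓝 0) := fun f hf =>
    tendsto_inv₀_cobounded.comp (tendsto_norm_atTop_iff_cobounded.mp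
      (tendsto_atTop_mono (fun ε => (le_abs_self _).trans (Complex.abs_im_le_norm _)) hf))
  have hi₁ := hinv _ h₁
  have hi₂ := hinv _ h₂
  have hz : Tendsto (fun ε : ℝ => (x : ℂ) + ε * I) (𝓝[>] 0) (𝓝 x) := by
    have : Continuous fun ε : ℝ => (x : ℂ) + ε * I := by fun_prop
    simpa using (this.tendsto 0).mono_left nhdsWithin_le_nhds
  have hlim : Tendsto (fun ε : ℝ => κ * (inner ℂ φ φ * (inner ℂ φ (R' (x + ε * I) φ))⁻¹ +
      ((x : ℂ) + ε * I - I)) * (inner ℂ φ φ * (inner ℂ φ (R (x + ε * I) φ))⁻¹ +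
      ((x : ℂ) + ε * I + I))) (𝓝[>] 0) (𝓝 (κ * (inner ℂ φ φ * 0 + ((x : ℂ) - I)) *
      (inner ℂ φ φ * 0 + ((x : ℂ) + I)))) :=
    (((hi₂.const_mul _).add (hz.sub_const I)).const_mul κ).mul
      ((hi₁.const_mul _).add (hz.add_const I))
  have hlim₂ := hi₂.sub hi₁
  -- Dividing the Aronszajn–Krein relation by the product of the two transforms and letting ε → 0
  -- leaves κ(x - i)(x + i) = 0.
  have heq : κ * (inner ℂ φ φ * 0 + ((x : ℂ) - I)) * (inner ℂ φ φ * 0 + ((x : ℂ) + I)) = 0 - 0 := by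
    refine tendsto_nhds_unique (hlim.congr' ?_) hlim₂
    filter_upwards [h₁.eventually_gt_atTop 0, h₂.eventually_gt_atTop 0, self_mem_nhdsWithin]
      with ε hε₁ hε₂ hε
    have him : ((x : ℂ) + ε * I).im ≠ 0 := by
      have : 0 < ε := hε
      simpa using this.ne'
    have hne₁ : inner ℂ φ (R (x + ε * I) φ) ≠ 0 := fun h0 => by simp [h0] at hε₁
    have hne₂ : inner ℂ φ (R' (x + ε * I) φ) ≠ 0 := fun h0 => by simp [h0] at hε₂
    have := hrel _ him
    generalize inner ℂ φ (R (x + ε * I) φ) = F at *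
    generalize inner ℂ φ (R' (x + ε * I) φ) = G at *
    generalize (inner ℂ φ φ : ℂ) = n at *
    field_simp
    linear_combination -this
  rw [mul_zero, zero_add, zero_add, sub_zero, mul_eq_zero, mul_eq_zero] at heq
  have hxI : (x : ℂ) - I ≠ 0 := ofReal_sub_ne_zero I_im_ne x
  have hxI' : (x : ℂ) + I ≠ 0 := by
    have := ofReal_sub_ne_zero (z := -I) (by simp) x
    rwa [sub_neg_eq_add] at this
  rcases heq with (h0 | h0) | h0
  · exact hκ h0
  · exact hxI h0
  · exact hxI' h0

/-! ### Cyclic subspaces under a rank one perturbation -/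

variable [CompleteSpace H]

theorem mem_cyclicSpan (h : IsRankOnePair R R' φ η) : η ∈ cyclicSpan R φ := by
  obtain ⟨κ, -, rfl⟩ := h.exists_eq_smul_cayley
  exact Submodule.smul_mem _ _ (Submodule.add_mem _ (h.left.mem_cyclicSpan_self φ)
    (Submodule.smul_mem _ _ (IsResolventFamily.apply_mem_cyclicSpan I_im_ne φ)))

/-- The correction to R z φ is a multiple of (1 + (z - i)R z)η, and η already lies in the cyclic
subspace of φ. Exchanging the two families gives the reverse inclusion. -/
theorem cyclicSpan_le (h : IsRankOnePair R R' φ η) : cyclicSpan R' φ ≤ cyclicSpan R φ := by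
  refine IsResolventFamily.cyclicSpan_le (IsResolventFamily.isClosed_cyclicSpan φ) fun z hz => ?_
  have h1 : R' z φ = R z φ - (R z φ - R' z φ) := by abel
  rw [h1, h.resolvent_sub hz]
  exact Submodule.sub_mem _ (IsResolventFamily.apply_mem_cyclicSpan hz φ)
    (Submodule.smul_mem _ _ (Submodule.add_mem _ h.mem_cyclicSpan
      (Submodule.smul_mem _ _ (h.left.apply_mem hz h.mem_cyclicSpan))))

theorem cyclicSpan_eq (h : IsRankOnePair R R' φ η) : cyclicSpan R' φ = cyclicSpan R φ :=
  le_antisymm h.cyclicSpan_le h.symm.cyclicSpan_le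

/-- The complement is invariant under R z, so the coefficient ⟨φ, x + (z - i)R z x⟩ of the rank one
correction vanishes. -/
theorem apply_eq_of_mem_orthogonal (h : IsRankOnePair R R' φ η) {z : ℂ} (hz : z.im ≠ 0) {x : H}
    (hx : x ∈ (cyclicSpan R φ)ᗮ) : R' z x = R z x := by
  have h1 := h.symm.resolvent_sub hz x
  have h2 : x + (z - I) • R z x ∈ (cyclicSpan R φ)ᗮ :=
    Submodule.add_mem _ hx (Submodule.smul_mem _ _ (h.left.apply_mem_orthogonal hz hx))
  rw [(Submodule.mem_orthogonal _ _).mp h2 φ (h.left.mem_cyclicSpan_self φ), zero_smul,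
    sub_eq_zero] at h1
  exact h1

end IsRankOnePair

/-- A carrier of the singular part on which a given almost everywhere property holds. -/
theorem exists_carrier_singularPart (μ : Measure ℝ) [IsFiniteMeasure μ] {p : ℝ → Prop}
    (hp : ∀ᵐ x ∂(μ.singularPart volume), p x) :
    ∃ S : Set ℝ, MeasurableSet S ∧ volume S = 0 ∧ μ.singularPart volume Sᶜ = 0 ∧
      ∀ x ∈ S, p x := by
  obtain ⟨s, hs, hs0, hsc⟩ := Measure.mutuallySingular_singularPart μ volume
  -- The exceptional set of p need not be measurable, so a measurable null hull of it is removed.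
  refine ⟨sᶜ \ toMeasurable (μ.singularPart volume) {x | ¬ p x},
    hs.compl.diff (measurableSet_toMeasurable _ _), measure_mono_null Set.sdiff_subset hsc, ?_, ?_⟩
  · rw [Set.sdiff_eq, Set.compl_inter, compl_compl, compl_compl]
    exact measure_union_null hs0 ((measure_toMeasurable _).trans hp)
  · intro x hx
    by_contra hpx
    exact hx.2 (subset_toMeasurable _ _ hpx)

/-- If `φ` and `ξ` together generate the space under the unperturbed family, and `ξ` is
dominated by `φ`, then the singular subspace of the perturbed family is cyclic. -/
theorem IsRankOnePair.exists_cyclicSpan_eq_singularVectors {H : Type*} [NormedAddCommGroup H]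
    [InnerProductSpace ℂ H] [CompleteSpace H] {R R' : ℂ → H →L[ℂ] H} {φ η : H}
    (h : IsRankOnePair R R' φ η) (ξ : H)
    (hle : ∀ z : ℂ, z.im ≠ 0 → ‖R z ξ‖ ≤ ‖R z φ‖)
    (hgen : ∀ v, (∀ z : ℂ, z.im ≠ 0 → inner ℂ (R z φ) v = 0) →
      (∀ z : ℂ, z.im ≠ 0 → inner ℂ (R z ξ) v = 0) → v = 0) :
    ∃ ψ ∈ singularVectors R', (cyclicSpan R' ψ : Set H) = singularVectors R' := by
  have : CompleteSpace (cyclicSpan R φ) :=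
    (IsResolventFamily.isClosed_cyclicSpan φ).completeSpace_coe
  obtain ⟨u, hu, χ, hχ, hξ⟩ := (cyclicSpan R φ).exists_add_mem_mem_orthogonal ξ
  have hRχ : ∀ z : ℂ, z.im ≠ 0 → R' z χ = R z χ := fun z hz => h.apply_eq_of_mem_orthogonal hz hχ
  have hχle : cyclicSpan R' χ ≤ (cyclicSpan R φ)ᗮ :=
    IsResolventFamily.cyclicSpan_le (Submodule.isClosed_orthogonal _) fun z hz => by
      rw [hRχ z hz]
      exact h.left.apply_mem_orthogonal hz hχ
  -- By Pythagoras, projecting ξ to χ only decreases the norm of its image under R z.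
  have hnorm : ∀ z : ℂ, z.im ≠ 0 → ‖R' z χ‖ ≤ ‖R z φ‖ := by
    intro z hz
    refine le_trans ?_ (hle z hz)
    have h0 : inner ℂ (R z u) (R z χ) = 0 := (Submodule.mem_orthogonal _ _).mp
      (h.left.apply_mem_orthogonal hz hχ) _ (h.left.apply_mem hz hu)
    have h1 := norm_add_sq_eq_norm_sq_add_norm_sq_of_inner_eq_zero _ _ h0
    rw [hξ, map_add, hRχ z hz]
    nlinarith [norm_nonneg (R z u), norm_nonneg (R z χ), norm_nonneg (R z u + R z χ)]
  obtain ⟨μ, hμ⟩ := h.right.exists_isSpectralMeasureFor φ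
  obtain ⟨ν, hν⟩ := h.right.exists_isSpectralMeasureFor χ
  have := hμ.1
  have := hν.1
  have him : ∀ {ε : ℝ}, ε ∈ Set.Ioi (0 : ℝ) → ∀ x : ℝ, ((x : ℂ) + ε * I).im ≠ 0 := by
    intro ε hε x
    have : 0 < ε := hε
    simpa using this.ne'
  obtain ⟨S, hS, hS0, hSμ, hSp⟩ := exists_carrier_singularPart μ
    (ae_singularPart_tendsto_im_stieltjes μ)
  obtain ⟨T, hT, hT0, hTν, hTp⟩ := exists_carrier_singularPart ν
    (ae_singularPart_tendsto_im_stieltjes ν)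
  refine h.right.exists_cyclicSpan_eq_singularVectors hμ hν ?_ ?_ hS hT ?_ hS0 hT0 hSμ hTν
  · intro a ha b hb
    rw [h.cyclicSpan_eq] at ha
    exact (Submodule.mem_orthogonal _ _).mp (hχle hb) a ha
  · intro v hv hv'
    rw [h.cyclicSpan_eq] at hv
    rw [Submodule.mem_orthogonal] at hv hv'
    refine hgen v (fun z hz => hv _ (IsResolventFamily.apply_mem_cyclicSpan hz φ)) fun z hz => ?_
    rw [hξ, map_add, inner_add_left, hv _ (h.left.apply_mem hz hu), zero_add, ← hRχ z hz]
    exact hv' _ (IsResolventFamily.apply_mem_cyclicSpan hz χ)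
  · rw [Set.disjoint_left]
    intro x hxS hxT
    refine h.not_tendsto_both x ?_ ?_
    -- Since Im⟨x, R z x⟩ = Im z ‖R z x‖², the norm bound moves the blow-up from χ under R' to φ
    -- under R.
    · refine tendsto_atTop_mono' _ ?_ (hTp x hxT)
      filter_upwards [self_mem_nhdsWithin] with ε hε
      have hz := him hε x
      have hε' : 0 < ((x : ℂ) + ε * I).im := by
        have : 0 < ε := hε
        simpa using this
      rw [← hν.2 _ hz, h.right.im_inner hz, h.left.im_inner hz]
      have := hnorm _ hz
      gcongr
    · refine (hSp x hxS).congr' ?_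
      filter_upwards [self_mem_nhdsWithin] with ε hε
      rw [hμ.2 _ (him hε x)]

/-! ### Resolvents of selfadjoint operators and of direct sums -/

section Resolvent

variable {H : Type*} [NormedAddCommGroup H] [InnerProductSpace ℂ H]

theorem IsResolvent.unique {A : H →ₗ.[ℂ] H} {z : ℂ} {R R' : H →L[ℂ] H} (h : IsResolvent A z R)
    (h' : IsResolvent A z R') : R = R' := by
  ext y
  obtain ⟨hy, hy'⟩ := h.1 y
  have := h'.2 ⟨R y, hy⟩
  rw [hy'] at this
  exact this.symm

theorem IsResolvent.resolvent_eq {A : H →ₗ.[ℂ] H} {z : ℂ} {R : H →L[ℂ] H}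
    (h : IsResolvent A z R) : resolvent A z = R := by
  have hex : ∃ R, IsResolvent A z R := ⟨R, h⟩
  rw [resolvent, dif_pos hex]
  exact hex.choose_spec.unique h

theorem isResolventFamily_resolvent [CompleteSpace H] {A : H →ₗ.[ℂ] H} (hA : IsSelfAdjoint A) :
    IsResolventFamily (resolvent A) where
  sub_eq z w hz hw := by
    ext y
    obtain ⟨hy, hy'⟩ := (isResolvent_resolvent hA hw).1 y
    have h := (isResolvent_resolvent hA hz).2 ⟨resolvent A w y, hy⟩
    have h1 : A ⟨resolvent A w y, hy⟩ - z • resolvent A w y = y - (z - w) • resolvent A w y := by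
      rw [eq_add_of_sub_eq hy']
      module
    rw [h1, map_sub, map_smul] at h
    change resolvent A z y - resolvent A w y = (z - w) • resolvent A z (resolvent A w y)
    rw [sub_eq_iff_eq_add] at h ⊢
    rw [h, add_comm]
  inner_left z hz x y := by
    obtain ⟨hx, hx'⟩ := (isResolvent_resolvent hA hz).1 x
    obtain ⟨hy, hy'⟩ := (isResolvent_resolvent hA (conj_im_ne hz)).1 y
    have hsymm := LinearPMap.adjoint_isFormalAdjoint hA.dense_domain
    rw [show LinearPMap.adjoint A = A from hA] at hsymm
    have h := hsymm ⟨_, hx⟩ ⟨_, hy⟩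
    rw [eq_add_of_sub_eq hx', eq_add_of_sub_eq hy', inner_add_left, inner_add_right,
      inner_smul_left, inner_smul_right] at h
    exact (add_right_cancel h).symm
  eq_zero z hz x hx := by
    obtain ⟨h, h'⟩ := (isResolvent_resolvent hA hz).1 x
    have h0 : (⟨resolvent A z x, h⟩ : A.domain) = 0 := Subtype.ext hx
    rw [h0, LinearPMap.map_zero, hx, smul_zero, sub_zero] at h'
    exact h'.symm

end Resolvent

/-! ### Resolvents of orthogonal sums -/

section DirectSum

variable {K₁ K₂ : Type*} [NormedAddCommGroup K₁] [InnerProductSpace ℂ K₁]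
  [NormedAddCommGroup K₂] [InnerProductSpace ℂ K₂]

/-- The diagonal operator `S ⊕ T`. -/
noncomputable def diagonal (S : K₁ →L[ℂ] K₁) (T : K₂ →L[ℂ] K₂) :
    WithLp 2 (K₁ × K₂) →L[ℂ] WithLp 2 (K₁ × K₂) :=
  (WithLp.prodContinuousLinearEquiv 2 ℂ K₁ K₂).symm.toContinuousLinearMap.comp
    ((S.prodMap T).comp (WithLp.prodContinuousLinearEquiv 2 ℂ K₁ K₂).toContinuousLinearMap)

theorem diagonal_apply (S : K₁ →L[ℂ] K₁) (T : K₂ →L[ℂ] K₂) (x : WithLp 2 (K₁ × K₂)) :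
    diagonal S T x = WithLp.toLp 2 (S x.fst, T x.snd) := rfl

theorem IsResolvent.directSum {A₁ : K₁ →ₗ.[ℂ] K₁} {A₂ : K₂ →ₗ.[ℂ] K₂} {z : ℂ}
    {R₁ : K₁ →L[ℂ] K₁} {R₂ : K₂ →L[ℂ] K₂} (h₁ : IsResolvent A₁ z R₁) (h₂ : IsResolvent A₂ z R₂) :
    IsResolvent (directSum A₁ A₂) z (diagonal R₁ R₂) := by
  constructor
  · intro y
    obtain ⟨hy₁, hy₁'⟩ := h₁.1 y.fst
    obtain ⟨hy₂, hy₂'⟩ := h₂.1 y.snd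
    refine ⟨⟨hy₁, hy₂⟩, ?_⟩
    exact congrArg (WithLp.toLp 2) (Prod.ext hy₁' hy₂')
  · intro x
    exact congrArg (WithLp.toLp 2) (Prod.ext (h₁.2 ⟨x.1.fst, x.2.1⟩) (h₂.2 ⟨x.1.snd, x.2.2⟩))

theorem IsResolventFamily.diagonal {R₁ : ℂ → K₁ →L[ℂ] K₁} {R₂ : ℂ → K₂ →L[ℂ] K₂}
    (h₁ : IsResolventFamily R₁) (h₂ : IsResolventFamily R₂) :
    IsResolventFamily fun z => diagonal (R₁ z) (R₂ z) where
  sub_eq z w hz hw := by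
    ext x
    exact congrArg (WithLp.toLp 2)
      (Prod.ext (h₁.sub_apply hz hw x.fst) (h₂.sub_apply hz hw x.snd))
  inner_left z hz x y := by
    exact congrArg₂ (· + ·) (h₁.inner_left z hz x.fst y.fst) (h₂.inner_left z hz x.snd y.snd)
  eq_zero z hz x hx := by
    have hx₁ : R₁ z x.fst = 0 := congrArg (fun y : WithLp 2 (K₁ × K₂) => y.fst) hx
    have hx₂ : R₂ z x.snd = 0 := congrArg (fun y : WithLp 2 (K₁ × K₂) => y.snd) hx
    exact congrArg (WithLp.toLp 2) (Prod.ext (h₁.eq_zero z hz _ hx₁) (h₂.eq_zero z hz _ hx₂))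

end DirectSum

/-- An operator of rank one is `⟨φ, ·⟩ η` for every nonzero `φ` orthogonal to its kernel. -/
theorem exists_eq_inner_smul_of_finrank_range_eq_one {H : Type*} [NormedAddCommGroup H]
    [InnerProductSpace ℂ H] {D : H →L[ℂ] H} (hrank : Module.finrank ℂ D.range = 1)
    {φ : H} (hφ : φ ∈ D.kerᗮ) (hφ0 : φ ≠ 0) : ∃ η, η ≠ 0 ∧ ∀ y, D y = inner ℂ φ y • η := by
  have hDφ : D φ ≠ 0 := fun h => hφ0 (inner_self_eq_zero.mp
    ((Submodule.mem_orthogonal _ _).mp hφ φ h))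
  have hn : (inner ℂ φ φ : ℂ) ≠ 0 := inner_self_ne_zero.mpr hφ0
  refine ⟨(inner ℂ φ φ : ℂ)⁻¹ • D φ, smul_ne_zero (inv_ne_zero hn) hDφ, fun y => ?_⟩
  have hne : (⟨D φ, φ, rfl⟩ : D.range) ≠ 0 := fun h => hDφ (congrArg Subtype.val h)
  obtain ⟨c, hc⟩ := (finrank_eq_one_iff_of_nonzero' _ hne).mp hrank ⟨D y, y, rfl⟩
  have hc : c • D φ = D y := congrArg Subtype.val hc
  have hker : D (y - c • φ) = 0 := by rw [map_sub, map_smul, hc, sub_self]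
  have h0 : inner ℂ φ (y - c • φ) = 0 :=
    inner_eq_zero_symm.mp ((Submodule.mem_orthogonal _ _).mp hφ _ hker)
  rw [inner_sub_right, inner_smul_right, sub_eq_zero] at h0
  rw [h0, smul_smul, mul_assoc, mul_inv_cancel₀ hn, mul_one, hc]

theorem IsCyclic.eq_zero_of_inner_eq_zero {H : Type*} [NormedAddCommGroup H]
    [InnerProductSpace ℂ H] {A : H →ₗ.[ℂ] H} {φ v : H} (hφ : IsCyclic A φ)
    (hv : ∀ z : ℂ, z.im ≠ 0 → inner ℂ (resolvent A z φ) v = 0) : v = 0 := by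
  have h1 : cyclicSpan (resolvent A) φ ≤ (Submodule.span ℂ {v})ᗮ :=
    IsResolventFamily.cyclicSpan_le (Submodule.isClosed_orthogonal _) fun z hz =>
      Submodule.mem_orthogonal_singleton_iff_inner_left.mpr (hv z hz)
  have h2 : v ∈ cyclicSpan (resolvent A) φ := by
    have h3 : cyclicSpan (resolvent A) φ = ⊤ := hφ
    rw [h3]
    exact Submodule.mem_top
  exact inner_self_eq_zero.mp (Submodule.mem_orthogonal_singleton_iff_inner_left.mp (h1 h2))

end UnboundedOp

/-! ### Proof of the theorem -/

theorem theorem4p2 {K₁ K₂ : Type*}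
    [NormedAddCommGroup K₁] [InnerProductSpace ℂ K₁] [CompleteSpace K₁]
    [NormedAddCommGroup K₂] [InnerProductSpace ℂ K₂] [CompleteSpace K₂]
    (A₁ : K₁ →ₗ.[ℂ] K₁) (A₂ : K₂ →ₗ.[ℂ] K₂)
    (C : WithLp 2 (K₁ × K₂) →ₗ.[ℂ] WithLp 2 (K₁ × K₂))
    (hA₁ : IsSelfAdjoint A₁) (hA₂ : IsSelfAdjoint A₂) (hC : IsSelfAdjoint C)
    (D : WithLp 2 (K₁ × K₂) →L[ℂ] WithLp 2 (K₁ × K₂))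
    (hD : D = UnboundedOp.resolvent (UnboundedOp.directSum A₁ A₂) Complex.I
      - UnboundedOp.resolvent C Complex.I)
    (hrank : Module.finrank ℂ D.range = 1)
    (φ : WithLp 2 (K₁ × K₂)) (hφ : φ ∈ D.kerᗮ)
    (hφ₁ : UnboundedOp.IsCyclic A₁ φ.fst) (hφ₂ : UnboundedOp.IsCyclic A₂ φ.snd) :
    UnboundedOp.HasSimpleSingularSpectrum C := by
  open UnboundedOp in
  have hgen : ∀ v : WithLp 2 (K₁ × K₂),
      (∀ z : ℂ, z.im ≠ 0 → inner ℂ (resolvent A₁ z φ.fst) v.fst = 0) →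
      (∀ z : ℂ, z.im ≠ 0 → inner ℂ (resolvent A₂ z φ.snd) v.snd = 0) → v = 0 := fun v h₁ h₂ =>
    congrArg (WithLp.toLp 2)
      (Prod.ext (hφ₁.eq_zero_of_inner_eq_zero h₁) (hφ₂.eq_zero_of_inner_eq_zero h₂))
  -- If φ were 0, cyclicity of its components would make both spaces trivial, contradicting rank
  -- one.
  have hφ0 : φ ≠ 0 := by
    rintro rfl
    have h0 : ∀ y, D y = 0 := fun y =>
      hgen _ (fun z _ => by simp) (fun z _ => by simp)
    have : D.range = ⊥ := by
      rw [Submodule.eq_bot_iff]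
      rintro _ ⟨y, rfl⟩
      exact h0 y
    rw [this, finrank_bot] at hrank
    exact zero_ne_one hrank
  obtain ⟨η, hη, hDη⟩ :=
    UnboundedOp.exists_eq_inner_smul_of_finrank_range_eq_one hrank hφ hφ0
  have hI := UnboundedOp.I_im_ne
  have hsum := ((UnboundedOp.isResolvent_resolvent hA₁ hI).directSum
    (UnboundedOp.isResolvent_resolvent hA₂ hI)).resolvent_eq
  have hpair : UnboundedOp.IsRankOnePair
      (fun z => UnboundedOp.diagonal (UnboundedOp.resolvent A₁ z) (UnboundedOp.resolvent A₂ z))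
      (UnboundedOp.resolvent C) φ η :=
    { left := (UnboundedOp.isResolventFamily_resolvent hA₁).diagonal
        (UnboundedOp.isResolventFamily_resolvent hA₂)
      right := UnboundedOp.isResolventFamily_resolvent hC
      ne_zero_left := hφ0
      ne_zero_right := hη
      sub_apply := fun y => by
        rw [← hDη, hD, hsum]
        rfl }
  -- The choice ξ = (Pφ, 0) is dominated by φ because the unperturbed resolvent is diagonal.
  -- Orthogonality to the orbits of ξ and φ separates into orthogonality in each summand, where
  -- cyclicity applies.
  refine hpair.exists_cyclicSpan_eq_singularVectors (WithLp.toLp 2 (φ.fst, 0)) ?_ ?_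
  · intro z _
    refine (sq_le_sq₀ (norm_nonneg _) (norm_nonneg _)).mp ?_
    simp only [UnboundedOp.diagonal_apply, WithLp.prod_norm_sq_eq_of_L2]
    simp
  · intro v h₁ h₂
    have h₁' : ∀ z : ℂ, z.im ≠ 0 →
        inner ℂ (UnboundedOp.resolvent A₁ z φ.fst) v.fst = 0 := fun z hz => by
      simpa [UnboundedOp.diagonal_apply, WithLp.prod_inner_apply] using h₂ z hz
    refine hgen v h₁' fun z hz => ?_
    have : inner ℂ (UnboundedOp.resolvent A₁ z φ.fst) v.fst +
        inner ℂ (UnboundedOp.resolvent A₂ z φ.snd) v.snd = 0 := h₁ z hz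
    rw [h₁' z hz, zero_add] at this
    exact this
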